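/- **Conventions.** Fix $n\ge 2$ qubits $a_1,\dots,a_n$. Let $R_x(\theta)=\begin{pmatrix}\cos\frac\theta2&-i\sin\frac\theta2\\-i\sin\frac\theta2&\cos\frac\theta2\end{pmatrix}$, and write $a_i\,R_x(\theta)\,a_j$ for $R_x(\theta)$ on $a_j$ conditioned on $a_i$ being $|1\rangle$ (equivalently, being $R_x(\pi)|0\rangle=-i|1\rangle$). The $n$-qubit Toffoli gate is $C^{n-1}R_x(\pi)$: the rotation $R_x(\pi)$ on $a_n$ conditioned on $a_1,\dots,a_{n-1}$. Put $\theta_{ij}=\pi/2^{j-i}$ for $2\le i<j$ and $\theta_{1j}=\pi/2^{j-2}$ for $j\geq 2$. **The (long-range) construction** is the sequence of parts $\mathcal C_1,\dots,\mathcal C_6$ of controlled rotations, in order of time: $\mathcal C_1$: for $i=n-1,n-2,\dots,2$ in this order, the gates $a_i R_x(\theta_{ij})a_j$, $i<j\le n$; $\mathcal C_2$: the gates $a_1R_x(\theta_{1j})a_j$, $2\le j\le n$; $\mathcal C_3$: for $i=2,3,\dots,n-1$ in this order, the gates $a_iR_x(-\theta_{ij})a_j$, $i<j\le n$; $\mathcal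 C_4$: as $\mathcal C_1$, but only with $j\le n-1$; $\mathcal C_5$: the gates $a_1R_x(-\theta_{1j})a_j$, $2\le j\le n-1$; $\mathcal C_6$: as $\mathcal C_3$, but only with $j\le n-1$. A *1D circuit* is a sequence of time steps. In each time step, controlled rotations and SWAP gates are executed on pairwise disjoint pairs of neighbouring sites of a line of $n$ sites. Its depth is the number of time steps. Its size is the number of 2-qubit operations, where elementary gates executed on the same pair of sites in consecutive time steps (such as a controlled rotation and the SWAP following it) form one 2-qubit operation. Two sequences of controlled rotations are *equal up to reordering* if one arises from the other by repeatedly exchanging neighbours neither of which has its control on the target of the other. **Theorem.** There is a constant $C$ such that for every $n\ge2$ there is a 1D circuit $c$, without ancilla, with the following properties. 1. $c$ implements the $n$-qubit Toffoli gate exactly and returns all qubits to their initial sites. All its gates are also allowed in every architecture on the same sites in which consecutive sites interact. Following the qubits through the SWAP gates, the controlled rotations that $c$ performs are those of $\mathcal C_1,\dots,\mathcal C_6$, up to reordering. 2. $c$ is the concatenation of six circuits $P_{12},P_3,K,P_{45},P_6,K'$. Up to reordering, $P_{12}$ performs the rotations of $\mathcal C_1,\mathcal C_2$, $P_3$ those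 of $\mathcal C_3$, $P_{45}$ those of $\mathcal C_4,\mathcal C_5$, and $P_6$ those of $\mathcal C_6$. The circuits $K$ and $K'$ consist of at most $4n-6$ SWAP gates each; $K$ restores the original qubit order midway, and $K'$ restores it at the end. The depths of $P_{12},P_3,K,P_{45},P_6,K'$ are at most $4n-6$, $4n-10$, $n+5$, $4n-10$, $4n-14$, $n+4$, respectively (a negative bound being read as $0$). 3. The total depth of $c$ (controlled rotations and SWAP gates occupying separate time steps) is at most $18n-31$. 4. The size of $c$ is $2n^2+O(n)$: it differs from $2n^2$ by at most $Cn$. Counted as elementary gates, $c$ has exactly $2n^2-6n+5$ controlled rotations, and a number of SWAP gates that differs from $2n^2$ by at most $Cn$. -/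

import Mathlib

/-! Quantum circuits on a register of `n` sites, in the computational basis `|0⟩, |1⟩`.
A basis state of the register is a function `Fin n → Fin 2`, and operators are complex matrices
`U x y = ⟨x| U |y⟩` indexed by basis states.  Conditioning on the basis vector
`R_x(π)|0⟩ = -i|1⟩` is the same as conditioning on `|1⟩`, since both span the same line. -/

namespace LinearToffoli

/-- The rotation by the angle `θ` around the `x` axis. -/
noncomputable def Rx (θ : ℝ) : Matrix (Fin 2) (Fin 2) ℂ :=
  !![(Real.cos (θ / 2) : ℂ), -Complex.I * (Real.sin (θ / 2) : ℂ);
     -Complex.I * (Real.sin (θ / 2) : ℂ), (Real.cos (θ / 2) : ℂ)]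

/-- `R_x(θ)` on qubit `t`, conditioned on all qubits in `S` being `1` (meant for `t ∉ S`). -/
noncomputable def ctrlRx {n : ℕ} (S : Finset (Fin n)) (t : Fin n) (θ : ℝ) :
    Matrix (Fin n → Fin 2) (Fin n → Fin 2) ℂ := fun x y =>
  if ∀ i, i ≠ t → x i = y i then
    (if ∀ i ∈ S, y i = 1 then Rx θ (x t) (y t) else (1 : Matrix (Fin 2) (Fin 2) ℂ) (x t) (y t))
  else 0

/-- The `n`-qubit Toffoli gate with target `t`: the `π`-rotation around the `x` axis on `t`
conditioned on all the other `n - 1` qubits. -/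
noncomputable def toffoli {n : ℕ} (t : Fin n) : Matrix (Fin n → Fin 2) (Fin n → Fin 2) ℂ :=
  ctrlRx (Finset.univ.erase t) t Real.pi

/-- A rotation `R_x(angle)` on `tgt` conditioned on `ctrl`. -/
structure Rot (n : ℕ) where
  angle : ℝ
  ctrl : Fin n
  tgt : Fin n

/-- The elementary two-qubit gates, placed on sites of the register. -/
inductive Gate (n : ℕ) where
  | rot (r : Rot n) : Gate n
  | swap (a b : Fin n) : Gate n

namespace Gate

/-- The sites on which a gate acts. -/
def sites {n : ℕ} : Gate n → Finset (Fin n)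
  | rot r => {r.ctrl, r.tgt}
  | swap a b => {a, b}

/-- The gate acts on two sites that interact in the architecture `G`. -/
def IsLocal {n : ℕ} (G : SimpleGraph (Fin n)) : Gate n → Prop
  | rot r => G.Adj r.ctrl r.tgt
  | swap a b => G.Adj a b

/-- `true` exactly for SWAP gates. -/
def isSwap {n : ℕ} : Gate n → Bool
  | rot _ => false
  | swap _ _ => true

/-- The operator of a gate. -/
noncomputable def matrix {n : ℕ} : Gate n → Matrix (Fin n → Fin 2) (Fin n → Fin 2) ℂ
  | rot r => ctrlRx {r.ctrl} r.tgt r.angle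
  | swap a b => fun x y => if x = y ∘ Equiv.swap a b then 1 else 0

end Gate

/-- The operator of a list of gates; the head of the list is applied first. -/
noncomputable def opOf {n : ℕ} : List (Gate n) → Matrix (Fin n → Fin 2) (Fin n → Fin 2) ℂ
  | [] => 1
  | g :: l => opOf l * g.matrix

/-- An arrangement `σ` says that site `s` holds qubit `σ s`.  A SWAP exchanges the qubits held by
two sites, other gates leave the arrangement unchanged. -/
def arrange {n : ℕ} : Equiv.Perm (Fin n) → List (Gate n) → Equiv.Perm (Fin n)
  | σ, [] => σ
  | σ, Gate.rot _ :: l => arrange σ l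
  | σ, Gate.swap a b :: l => arrange (σ * Equiv.swap a b) l

/-- The controlled rotations that a list of gates performs, in order of time and expressed in the
qubits (not the sites) on which they act, when it is started in the arrangement `σ`. -/
def rotations {n : ℕ} : Equiv.Perm (Fin n) → List (Gate n) → List (Rot n)
  | _, [] => []
  | σ, Gate.rot r :: l => ⟨r.angle, σ r.ctrl, σ r.tgt⟩ :: rotations σ l
  | σ, Gate.swap a b :: l => rotations (σ * Equiv.swap a b) l

/-- A circuit is the list of its time steps, each being the list of the gates executed in it. -/
abbrev Circuit (n : ℕ) := List (List (Gate n))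

namespace Circuit

/-- The gates executed in one time step act on pairwise disjoint sets of sites. -/
def IsScheduled {n : ℕ} (c : Circuit n) : Prop :=
  ∀ L ∈ c, L.Pairwise fun g h => Disjoint g.sites h.sites

/-- Every gate of the circuit acts on two sites that interact in `G`. -/
def IsLocal {n : ℕ} (G : SimpleGraph (Fin n)) (c : Circuit n) : Prop :=
  ∀ L ∈ c, ∀ g ∈ L, g.IsLocal G

/-- The circuit consists of SWAP gates only. -/
def OnlySwaps {n : ℕ} (c : Circuit n) : Prop :=
  ∀ L ∈ c, ∀ g ∈ L, g.isSwap = true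

/-- The gates of the circuit in order of time. -/
def gates {n : ℕ} (c : Circuit n) : List (Gate n) := List.flatten c

/-- The operator of the circuit. -/
noncomputable def op {n : ℕ} (c : Circuit n) : Matrix (Fin n → Fin 2) (Fin n → Fin 2) ℂ :=
  opOf c.gates

/-- The depth: the number of time steps. -/
def depth {n : ℕ} (c : Circuit n) : ℕ := List.length c

/-- The number of SWAP gates. -/
def swapCount {n : ℕ} (c : Circuit n) : ℕ := c.gates.countP fun g => g.isSwap

/-- The number of controlled rotations. -/
def rotCount {n : ℕ} (c : Circuit n) : ℕ := c.gates.countP fun g => !g.isSwap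

/-- Auxiliary to `size`; `prev` is the preceding time step. -/
def sizeFrom {n : ℕ} : List (Gate n) → List (List (Gate n)) → ℕ
  | _, [] => 0
  | prev, L :: c =>
      (L.filter fun g => decide (∀ h ∈ prev, h.sites ≠ g.sites)).length + sizeFrom L c

/-- The size: the number of two-qubit operations, where elementary gates that act in consecutive
time steps on the same pair of sites (such as a controlled rotation followed by a SWAP) form a
single two-qubit operation.  So a gate is counted unless the preceding time step has a gate on the
same pair. -/
def size {n : ℕ} (c : Circuit n) : ℕ := sizeFrom [] c

end Circuit

/-- `l'` arises from `l` by exchanging two consecutive controlled rotations neither of which has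
its control on the target of the other one (such rotations commute). -/
inductive Exchange {n : ℕ} : List (Rot n) → List (Rot n) → Prop
  | mk (l₁ l₂ : List (Rot n)) (r s : Rot n) (h₁ : r.ctrl ≠ s.tgt) (h₂ : s.ctrl ≠ r.tgt) :
      Exchange (l₁ ++ r :: s :: l₂) (l₁ ++ s :: r :: l₂)

/-- Two lists of controlled rotations agree up to such exchanges. -/
def Reordering {n : ℕ} : List (Rot n) → List (Rot n) → Prop :=
  Relation.ReflTransGen Exchange

/-! The long-range construction.  Qubit `a_{i+1}` of the usual numbering `a_1, …, a_n` is
`i : Fin n`; the target of the Toffoli gate is the last qubit. -/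

/-- The angle of the rotation on `j` conditioned on `i < j`, up to sign: `π / 2 ^ (j - i)`, except
that it is `π / 2 ^ (j - 1)` for the first qubit `i = 0`. -/
noncomputable def angle (i j : ℕ) : ℝ :=
  Real.pi / 2 ^ (if i = 0 then j - 1 else j - i)

/-- The rotations with control `i` and targets `i + 1, …, m - 1`, with sign `ε`. -/
noncomputable def fan {n : ℕ} (ε : ℝ) (m : ℕ) (i : Fin n) : List (Rot n) :=
  ((List.finRange n).filter fun j : Fin n => decide (i.val < j.val ∧ j.val < m)).map
    fun j : Fin n => ⟨ε * angle i.val j.val, i, j⟩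

/-- The qubits `1, …, n - 1` in increasing order. -/
def tailQubits (n : ℕ) : List (Fin n) := (List.finRange n).filter fun i => decide (0 < i.val)

/-- The list consisting of the qubit `0` (empty if `n = 0`). -/
def headQubit (n : ℕ) : List (Fin n) := (List.finRange n).filter fun i => decide (i.val = 0)

/-- First part: positive rotations, controls `n - 1, …, 1` in this order, targets up to `n - 1`. -/
noncomputable def part1 (n : ℕ) : List (Rot n) := (tailQubits n).reverse.flatMap (fan 1 n)

/-- Second part: positive rotations with control `0`. -/
noncomputable def part2 (n : ℕ) : List (Rot n) := (headQubit n).flatMap (fan 1 n)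

/-- Third part: negative rotations, controls `1, …, n - 1` in this order. -/
noncomputable def part3 (n : ℕ) : List (Rot n) := (tailQubits n).flatMap (fan (-1) n)

/-- Fourth part: the first part without the last qubit. -/
noncomputable def part4 (n : ℕ) : List (Rot n) := (tailQubits n).reverse.flatMap (fan 1 (n - 1))

/-- Fifth part: the second part without the last qubit and with negative angles. -/
noncomputable def part5 (n : ℕ) : List (Rot n) := (headQubit n).flatMap (fan (-1) (n - 1))

/-- Sixth part: the third part without the last qubit. -/
noncomputable def part6 (n : ℕ) : List (Rot n) := (tailQubits n).flatMap (fan (-1) (n - 1))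

/-- The whole construction, in order of time. -/
noncomputable def construction (n : ℕ) : List (Rot n) :=
  part1 n ++ part2 n ++ part3 n ++ part4 n ++ part5 n ++ part6 n

end LinearToffoli

/-! Number the qubits `0, …, n - 1`.

*The construction is a Toffoli gate.*  Let `U m` be the operator of the first three parts with
targets below `m`: the rotations `V` of the controls `1, …, m - 1`, then the fan of qubit `0`, then
the inverse of `V`.  On basis states, `U m` adds the bit of qubit `0` to the binary number in the
qubits `1, …, m - 1`, up to phases (`IsIncrement`).  To see this, pass from `m = t` to `t + 1`: the
rotations on the new target `t` can be executed first (those before the increment) and last (those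
after it).  Together with the rotation by qubit `0` they turn `t` by `π / 2 ^ (t - 1)` times
`a + b - a'`, where `a` and `a'` are the numbers in the lower qubits before and after the increment
by the bit `b` of qubit `0`; this is `π` if the increment overflows and `0` if not.  Hence
`U (t + 1)` is `U t` preceded by the `π`-rotation of `t` conditioned on all the qubits before it
(`IsIncrement.run_succ`).  The last three parts are the inverse of `U (n - 1)`, and only the Toffoli
gate remains (`opOf_construction`).

*The circuit.*  Two lists of the same rotations agree up to reordering as soon as both order any two
conflicting rotations by their controls (`Reordering.of_perm`).  The triangular network on `m` sites
lets every two of the `m` qubits meet exactly once, in `2 * m - 3` layers of rotations followed by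
SWAP gates on the same pairs, and reverses their order; the arrangement after each layer is known
explicitly (`qubitAt`).  The pairs `i`, `j` meet in the order of decreasing `i + j`, which is
compatible with decreasing controls as the first two parts require (`reordering_triangle`).
Started in the reversed arrangement, without qubit `0`, the same network serves the third part,
where the controls increase (`reordering_triangle_reverse`).  Both networks together shift the
qubits `1, …, n - 1` by one site, so that it remains to move qubit `0` back to the first site by
`n - 1` SWAP gates (`arrange_triangle_triangle_moveDown`).  The last three parts are treated in the
same way, on one site less. -/

namespace LinearToffoli

/-! ### Reorderings -/

/-- One of the two rotations has its control on the target of the other one. -/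
def Conflict {n : ℕ} (r s : Rot n) : Prop := r.ctrl = s.tgt ∨ s.ctrl = r.tgt

theorem Conflict.symm {n : ℕ} {r s : Rot n} (h : Conflict r s) : Conflict s r := Or.symm h

namespace Reordering

variable {n : ℕ}

theorem append_left (a : List (Rot n)) {l l' : List (Rot n)} (h : Reordering l l') :
    Reordering (a ++ l) (a ++ l') := by
  refine Relation.ReflTransGen.lift (a ++ ·) ?_ _ _ h
  rintro _ _ ⟨l₁, l₂, r, s, h₁, h₂⟩
  simpa using Exchange.mk (a ++ l₁) l₂ r s h₁ h₂

theorem append_right (a : List (Rot n)) {l l' : List (Rot n)} (h : Reordering l l') :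
    Reordering (l ++ a) (l' ++ a) := by
  refine Relation.ReflTransGen.lift (· ++ a) ?_ _ _ h
  rintro _ _ ⟨l₁, l₂, r, s, h₁, h₂⟩
  simpa [Function.onFun] using Exchange.mk l₁ (l₂ ++ a) r s h₁ h₂

theorem append {a a' l l' : List (Rot n)} (h : Reordering a a') (h' : Reordering l l') :
    Reordering (a ++ l) (a' ++ l') :=
  (h'.append_left a).trans (h.append_right l')

theorem perm {l l' : List (Rot n)} (h : Reordering l l') : l.Perm l' := by
  induction h with
  | refl => exact .refl _
  | tail _ h ih =>
    obtain ⟨l₁, l₂, r, s, -, -⟩ := h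
    exact ih.trans ((List.Perm.swap s r l₂).append_left l₁)

theorem move_to_front (r : Rot n) (l₂ : List (Rot n)) :
    ∀ l₁ : List (Rot n), (∀ s ∈ l₁, ¬ Conflict s r) →
      Reordering (l₁ ++ r :: l₂) (r :: (l₁ ++ l₂))
  | [], _ => .refl
  | s :: l₁, h => by
    have ih := move_to_front r l₂ l₁ fun a ha => h a (List.mem_cons_of_mem _ ha)
    have hs := h s List.mem_cons_self
    refine (ih.append_left [s]).tail ?_
    exact Exchange.mk [] (l₁ ++ l₂) s r (fun e => hs (.inl e)) (fun e => hs (.inr e))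

/-- Two permutations of the same rotations agree up to reordering if an asymmetric relation `P`
prescribes, in both of them, which one of two conflicting rotations comes first. -/
theorem of_perm {P : Rot n → Rot n → Prop} (hP : ∀ r s, P r s → ¬ P s r) :
    ∀ {l l' : List (Rot n)}, l.Perm l' → l.Pairwise (fun r s => Conflict r s → P r s) →
      l'.Pairwise (fun r s => Conflict r s → P r s) → Reordering l l'
  | l, [], hp, _, _ => by rw [hp.eq_nil]; exact .refl
  | l, r :: l', hp, hl, hl' => by
    obtain ⟨l₁, l₂, rfl⟩ := List.append_of_mem (hp.mem_iff.2 List.mem_cons_self)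
    have hp' : (l₁ ++ l₂).Perm l' := (List.perm_middle.symm.trans hp).cons_inv
    rw [List.pairwise_cons] at hl'
    have h₁ : ∀ s ∈ l₁, ¬ Conflict s r := fun s hs hc =>
      hP s r ((List.pairwise_append.1 hl).2.2 s hs r List.mem_cons_self hc)
        (hl'.1 s (hp'.mem_iff.1 (List.mem_append_left _ hs)) hc.symm)
    refine (move_to_front r l₂ l₁ h₁).trans ?_
    refine append_left [r] (of_perm hP hp' (hl.sublist ?_) hl'.2)
    exact (List.Sublist.refl l₁).append (List.sublist_cons_self r l₂)

end Reordering

/-! ### Following the qubits through the SWAP gates -/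

section Arrangement

variable {n : ℕ}

theorem arrange_append (l l' : List (Gate n)) (σ : Equiv.Perm (Fin n)) :
    arrange σ (l ++ l') = arrange (arrange σ l) l' := by
  induction l generalizing σ with
  | nil => rfl
  | cons g l ih => cases g <;> exact ih _

theorem rotations_append (l l' : List (Gate n)) (σ : Equiv.Perm (Fin n)) :
    rotations σ (l ++ l') = rotations σ l ++ rotations (arrange σ l) l' := by
  induction l generalizing σ with
  | nil => rfl
  | cons g l ih =>
    cases g with
    | rot r => exact congrArg _ (ih _)
    | swap a b => exact ih _

theorem length_rotations (l : List (Gate n)) (σ : Equiv.Perm (Fin n)) :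
    (rotations σ l).length = l.countP fun g => !g.isSwap := by
  induction l generalizing σ with
  | nil => rfl
  | cons g l ih => cases g <;> simp [rotations, Gate.isSwap, ih]

theorem rotations_eq_nil {l : List (Gate n)} (h : ∀ g ∈ l, g.isSwap = true)
    (σ : Equiv.Perm (Fin n)) : rotations σ l = [] := by
  rw [← List.length_eq_zero_iff, length_rotations, List.countP_eq_zero]
  simpa using h

/-- The operator that moves qubit `σ s` to site `s`. -/
def moveMatrix (σ : Equiv.Perm (Fin n)) : Matrix (Fin n → Fin 2) (Fin n → Fin 2) ℂ :=
  fun x y => if x = y ∘ σ then 1 else 0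

theorem mul_moveMatrix (A : Matrix (Fin n → Fin 2) (Fin n → Fin 2) ℂ) (σ : Equiv.Perm (Fin n))
    (x y : Fin n → Fin 2) : (A * moveMatrix σ) x y = A x (y ∘ σ) := by
  simp [Matrix.mul_apply, moveMatrix]

theorem moveMatrix_mul (A : Matrix (Fin n → Fin 2) (Fin n → Fin 2) ℂ) (σ : Equiv.Perm (Fin n))
    (x y : Fin n → Fin 2) : (moveMatrix σ * A) x y = A (x ∘ σ.symm) y := by
  have h : ∀ z : Fin n → Fin 2, x = z ∘ σ ↔ z = x ∘ σ.symm := fun z => by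
    constructor
    · rintro rfl; ext i; simp
    · rintro rfl; ext i; simp
  simp [Matrix.mul_apply, moveMatrix, h]

theorem moveMatrix_one : moveMatrix (1 : Equiv.Perm (Fin n)) = 1 := by
  ext x y; simp [moveMatrix, Matrix.one_apply]

theorem swap_mul_moveMatrix (a b : Fin n) (σ : Equiv.Perm (Fin n)) :
    (Gate.swap a b).matrix * moveMatrix σ = moveMatrix (σ * Equiv.swap a b) := by
  ext x y
  rw [mul_moveMatrix]
  rfl

theorem rot_mul_moveMatrix (r : Rot n) (σ : Equiv.Perm (Fin n)) :
    (Gate.rot r).matrix * moveMatrix σ =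
      moveMatrix σ * (Gate.rot ⟨r.angle, σ r.ctrl, σ r.tgt⟩).matrix := by
  ext x y
  rw [mul_moveMatrix, moveMatrix_mul]
  have h : (∀ i, i ≠ r.tgt → x i = y (σ i)) ↔ ∀ i, i ≠ σ r.tgt → x (σ.symm i) = y i := by
    constructor
    · intro h i hi
      simpa using h (σ.symm i) (fun e => hi (by simp [← e]))
    · intro h i hi
      simpa using h (σ i) (fun e => hi (σ.injective e))
  simp [Gate.matrix, ctrlRx, h, Matrix.one_apply]

/-- The operator of a list of gates is that of the rotations it performs on the qubits, followed
by the permutation of the qubits that its SWAP gates amount to. -/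
theorem opOf_mul_moveMatrix (l : List (Gate n)) (σ : Equiv.Perm (Fin n)) :
    opOf l * moveMatrix σ = moveMatrix (arrange σ l) * opOf ((rotations σ l).map Gate.rot) := by
  induction l generalizing σ with
  | nil => simp [opOf, arrange, rotations]
  | cons g l ih =>
    cases g with
    | rot r =>
      simp only [opOf, arrange, rotations, List.map_cons]
      rw [mul_assoc, rot_mul_moveMatrix, ← mul_assoc, ih, mul_assoc]
    | swap a b =>
      simp only [opOf, arrange, rotations]
      rw [mul_assoc, swap_mul_moveMatrix, ih]

theorem opOf_eq_of_arrange_eq_one {l : List (Gate n)} (h : arrange 1 l = 1) :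
    opOf l = opOf ((rotations 1 l).map Gate.rot) := by
  simpa [h, moveMatrix_one] using opOf_mul_moveMatrix l 1

end Arrangement

/-! ### Rotations acting on state vectors -/

section Turn

variable {n : ℕ}

/-- The basis state with the bit of qubit `t` flipped. -/
def flip (t : Fin n) (x : Fin n → Fin 2) : Fin n → Fin 2 := Function.update x t (x t + 1)

theorem flip_same (t : Fin n) (x : Fin n → Fin 2) : flip t x t = x t + 1 := by simp [flip]

theorem flip_of_ne {t i : Fin n} (h : i ≠ t) (x : Fin n → Fin 2) : flip t x i = x i := by
  simp [flip, h]

theorem flip_flip (t : Fin n) (x : Fin n → Fin 2) : flip t (flip t x) = x := by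
  have h : ∀ a : Fin 2, a + 1 + 1 = a := by decide
  ext1 i
  by_cases hi : i = t
  · subst hi; rw [flip_same, flip_same, h]
  · rw [flip_of_ne hi, flip_of_ne hi]

theorem flip_comm (t t' : Fin n) (x : Fin n → Fin 2) :
    flip t (flip t' x) = flip t' (flip t x) := by
  by_cases h : t = t'
  · rw [h]
  · ext1 i
    by_cases hi : i = t
    · subst hi
      rw [flip_same, flip_of_ne h, flip_of_ne h, flip_same]
    · by_cases hi' : i = t'
      · subst hi'
        rw [flip_of_ne hi, flip_same, flip_same, flip_of_ne hi]
      · simp [flip_of_ne hi, flip_of_ne hi']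

/-- The rotation of qubit `t` around the `x` axis by an angle `α` that may depend on the basis
state of the other qubits, acting on a state vector. -/
noncomputable def turn (t : Fin n) (α : (Fin n → Fin 2) → ℝ) (v : (Fin n → Fin 2) → ℂ) :
    (Fin n → Fin 2) → ℂ := fun x =>
  (Real.cos (α x / 2) : ℂ) * v x - Complex.I * (Real.sin (α x / 2) : ℂ) * v (flip t x)

theorem turn_zero (t : Fin n) (v : (Fin n → Fin 2) → ℂ) : turn t (fun _ => 0) v = v := by
  ext x; simp [turn]

theorem turn_turn {t : Fin n} {α β : (Fin n → Fin 2) → ℝ} (hβ : ∀ x, β (flip t x) = β x)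
    (v : (Fin n → Fin 2) → ℂ) :
    turn t α (turn t β v) = turn t (fun x => α x + β x) v := by
  ext x
  simp only [turn, hβ, flip_flip, add_div, Real.cos_add, Real.sin_add]
  push_cast
  linear_combination
    (Complex.sin (α x / 2) * Complex.sin (β x / 2) * v x) * Complex.I_mul_I

theorem turn_comm {t t' : Fin n} {α α' : (Fin n → Fin 2) → ℝ} (hα : ∀ x, α (flip t' x) = α x)
    (hα' : ∀ x, α' (flip t x) = α' x) (v : (Fin n → Fin 2) → ℂ) :
    turn t α (turn t' α' v) = turn t' α' (turn t α v) := by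
  ext x
  simp only [turn, hα, hα', flip_comm t' t]
  ring

/-- The angle by which `ctrlRx S t θ` turns the qubit `t`. -/
noncomputable def ctrlAngle (S : Finset (Fin n)) (θ : ℝ) (x : Fin n → Fin 2) : ℝ :=
  if ∀ i ∈ S, x i = 1 then θ else 0

theorem ctrlAngle_singleton (c : Fin n) (θ : ℝ) (x : Fin n → Fin 2) :
    ctrlAngle {c} θ x = if x c = 1 then θ else 0 := by
  simp [ctrlAngle]

theorem ctrlAngle_flip {S : Finset (Fin n)} {t : Fin n} (h : t ∉ S) (θ : ℝ)
    (x : Fin n → Fin 2) : ctrlAngle S θ (flip t x) = ctrlAngle S θ x := by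
  have : (∀ i ∈ S, flip t x i = 1) ↔ ∀ i ∈ S, x i = 1 :=
    forall₂_congr fun i hi => by rw [flip_of_ne (ne_of_mem_of_not_mem hi h)]
  simp only [ctrlAngle, this]

theorem ctrlRx_mulVec {S : Finset (Fin n)} {t : Fin n} (h : t ∉ S) (θ : ℝ)
    (v : (Fin n → Fin 2) → ℂ) :
    (ctrlRx S t θ).mulVec v = turn t (ctrlAngle S θ) v := by
  have two : ∀ a b : Fin 2, a = b ∨ a = b + 1 := by decide
  have ne : ∀ a : Fin 2, a ≠ a + 1 := by decide
  ext x
  have hx : x ≠ flip t x := fun e => ne (x t) (by rw [← flip_same, ← e])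
  rw [Matrix.mulVec, dotProduct, Finset.sum_eq_add x (flip t x) hx]
  · have h1 : (∀ i, i ≠ t → x i = flip t x i) := fun i hi => (flip_of_ne hi x).symm
    have h2 : (∀ i ∈ S, flip t x i = 1) ↔ ∀ i ∈ S, x i = 1 :=
      forall₂_congr fun i hi => by rw [flip_of_ne (ne_of_mem_of_not_mem hi h)]
    have h3 : Rx θ (x t) (x t) = Real.cos (θ / 2) := by
      rcases two (x t) 0 with e | e <;> simp [e, Rx]
    have h4 : Rx θ (x t) (x t + 1) = -Complex.I * Real.sin (θ / 2) := by
      rcases two (x t) 0 with e | e <;> simp [e, Rx]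
    have h5 : ctrlRx S t θ x x =
        if ∀ i ∈ S, x i = 1 then (Real.cos (θ / 2) : ℂ) else 1 := by
      simp [ctrlRx, h3]
    have h6 : ctrlRx S t θ x (flip t x) =
        if ∀ i ∈ S, x i = 1 then -Complex.I * (Real.sin (θ / 2) : ℂ) else 0 := by
      rw [ctrlRx, if_pos h1, flip_same, h4]
      simp only [h2, Matrix.one_apply, if_neg (ne _)]
    rw [h5, h6]
    simp only [turn, ctrlAngle]
    split_ifs with hS
    · ring
    · simp
  · rintro y - ⟨hy1, hy2⟩
    rw [ctrlRx, if_neg, zero_mul]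
    intro hxy
    rcases two (y t) (x t) with e | e
    · refine hy1 (funext fun i => ?_)
      by_cases hi : i = t
      · rw [hi, e]
      · exact (hxy i hi).symm
    · refine hy2 (funext fun i => ?_)
      by_cases hi : i = t
      · rw [hi, e, flip_same]
      · rw [flip_of_ne hi, hxy i hi]
  · simp
  · simp

/-- The action of a list of controlled rotations on a state vector; the head of the list is
applied first. -/
noncomputable def run : List (Rot n) → ((Fin n → Fin 2) → ℂ) → ((Fin n → Fin 2) → ℂ)
  | [], v => v
  | r :: l, v => run l (turn r.tgt (ctrlAngle {r.ctrl} r.angle) v)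

theorem run_append (l l' : List (Rot n)) (v : (Fin n → Fin 2) → ℂ) :
    run (l ++ l') v = run l' (run l v) := by
  induction l generalizing v with
  | nil => rfl
  | cons r l ih => exact ih _

theorem opOf_mulVec {l : List (Rot n)} (h : ∀ r ∈ l, r.ctrl ≠ r.tgt) (v : (Fin n → Fin 2) → ℂ) :
    (opOf (l.map Gate.rot)).mulVec v = run l v := by
  induction l generalizing v with
  | nil => simp [opOf, run]
  | cons r l ih =>
    rw [List.map_cons, opOf, ← Matrix.mulVec_mulVec, ih fun s hs => h s (List.mem_cons_of_mem _ hs)]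
    rw [Gate.matrix, ctrlRx_mulVec (by simpa using (h r List.mem_cons_self).symm), run]

theorem Reordering.run_eq {l l' : List (Rot n)} (h : Reordering l l') : run l = run l' := by
  induction h with
  | refl => rfl
  | tail _ h ih =>
    obtain ⟨l₁, l₂, r, s, h₁, h₂⟩ := h
    rw [ih]
    ext1 v
    simp only [run_append, run]
    rw [turn_comm]
    · exact ctrlAngle_flip (by simpa using h₂.symm) _
    · exact ctrlAngle_flip (by simpa using h₁.symm) _

/-- The rotation by the opposite angle. -/
def Rot.neg (r : Rot n) : Rot n := ⟨-r.angle, r.ctrl, r.tgt⟩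

theorem run_reverse_neg {l : List (Rot n)} (h : ∀ r ∈ l, r.ctrl ≠ r.tgt)
    (v : (Fin n → Fin 2) → ℂ) : run (l.map Rot.neg).reverse (run l v) = v := by
  induction l generalizing v with
  | nil => rfl
  | cons r l ih =>
    simp only [List.map_cons, List.reverse_cons, run_append, run]
    rw [ih fun s hs => h s (List.mem_cons_of_mem _ hs)]
    rw [show r.neg.tgt = r.tgt from rfl, turn_turn]
    · convert turn_zero r.tgt v using 2
      ext x
      rw [ctrlAngle_singleton, ctrlAngle_singleton]
      by_cases hx : x r.ctrl = 1 <;> simp [Rot.neg, hx]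
    · exact ctrlAngle_flip (by simpa using (h r List.mem_cons_self).symm) _

/-- Rotations of the same qubit add up. -/
theorem run_same_target {t : Fin n} {l : List (Rot n)} (h : ∀ r ∈ l, r.tgt = t ∧ r.ctrl ≠ t)
    (v : (Fin n → Fin 2) → ℂ) :
    run l v = turn t (fun x => (l.map fun r => ctrlAngle {r.ctrl} r.angle x).sum) v := by
  induction l generalizing v with
  | nil => simp [run, turn_zero]
  | cons r l ih =>
    obtain ⟨h1, h2⟩ := h r List.mem_cons_self
    rw [run, ih fun s hs => h s (List.mem_cons_of_mem _ hs), h1, turn_turn]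
    · congr 1; ext x; simp [add_comm]
    · exact ctrlAngle_flip (by simpa using h2.symm) _

end Turn

/-! ### The fans of the construction -/

section Fans

variable {n : ℕ}

/-- The list `l` consists, without repetition, of the rotations by the angles `α i j` on `j`
conditioned on `i`, for all pairs `(i, j)` in the relation `Q`. -/
def Enumerates (l : List (Rot n)) (Q : Fin n → Fin n → Prop) (α : Fin n → Fin n → ℝ) : Prop :=
  l.Nodup ∧ ∀ r, r ∈ l ↔ Q r.ctrl r.tgt ∧ r.angle = α r.ctrl r.tgt

namespace Enumerates

variable {l l' : List (Rot n)} {Q Q' : Fin n → Fin n → Prop} {α α' : Fin n → Fin n → ℝ}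

theorem perm (h : Enumerates l Q α) (h' : Enumerates l' Q' α') (hQ : ∀ i j, Q i j ↔ Q' i j)
    (hα : ∀ i j, Q i j → α i j = α' i j) : l.Perm l' := by
  refine (List.perm_ext_iff_of_nodup h.1 h'.1).2 fun r => ?_
  rw [h.2, h'.2, ← hQ]
  exact and_congr_right fun hr => by rw [hα _ _ hr]

theorem append (h : Enumerates l Q α) (h' : Enumerates l' Q' α')
    (hQ : ∀ i j, Q i j → ¬ Q' i j) {β : Fin n → Fin n → ℝ} (hα : ∀ i j, Q i j → α i j = β i j)
    (hα' : ∀ i j, Q' i j → α' i j = β i j) :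
    Enumerates (l ++ l') (fun i j => Q i j ∨ Q' i j) β := by
  refine ⟨List.nodup_append'.2 ⟨h.1, h'.1, fun r hr hr' =>
    hQ _ _ ((h.2 r).1 hr).1 ((h'.2 r).1 hr').1⟩, fun r => ?_⟩
  rw [List.mem_append, h.2, h'.2, or_and_right]
  exact or_congr (and_congr_right fun hr => by rw [hα _ _ hr])
    (and_congr_right fun hr => by rw [hα' _ _ hr])

theorem reverse_neg (h : Enumerates l Q α) :
    Enumerates (l.map Rot.neg).reverse Q fun i j => -α i j := by
  have hneg : ∀ r : Rot n, r.neg.neg = r := fun r => by simp [Rot.neg]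
  have hinj : Function.Injective (Rot.neg (n := n)) := fun r s e => by
    rw [← hneg r, e, hneg]
  refine ⟨List.nodup_reverse.2 (h.1.map hinj), fun r => ?_⟩
  rw [List.mem_reverse, ← hneg r, List.mem_map_of_injective hinj, h.2]
  simp [Rot.neg, neg_eq_iff_eq_neg]

end Enumerates

theorem mem_fan {ε : ℝ} {m : ℕ} {i : Fin n} {r : Rot n} :
    r ∈ fan ε m i ↔
      (r.ctrl = i ∧ i < r.tgt ∧ r.tgt.val < m) ∧ r.angle = ε * angle r.ctrl r.tgt := by
  simp only [fan, List.mem_map, List.mem_filter, List.mem_finRange, true_and, decide_eq_true_eq]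
  constructor
  · rintro ⟨j, h, rfl⟩
    exact ⟨⟨rfl, h⟩, rfl⟩
  · rintro ⟨⟨rfl, h⟩, h'⟩
    exact ⟨r.tgt, h, by rw [← h']⟩

theorem nodup_fan (ε : ℝ) (m : ℕ) (i : Fin n) : (fan ε m i).Nodup := by
  refine List.Nodup.map ?_ ((List.nodup_finRange n).filter _)
  intro j j' h
  exact congrArg Rot.tgt h

theorem enumerates_fans (ε : ℝ) (m : ℕ) {I : List (Fin n)} (hI : I.Nodup) :
    Enumerates (I.flatMap (fan ε m)) (fun i j => i ∈ I ∧ i < j ∧ j.val < m)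
      (fun i j => ε * angle i j) := by
  refine ⟨List.nodup_flatMap.2 ⟨fun i _ => nodup_fan ε m i, ?_⟩, fun r => ?_⟩
  · refine hI.imp fun {i j} hij r hr hr' => hij ?_
    rw [← (mem_fan.1 hr).1.1, (mem_fan.1 hr').1.1]
  · simp only [List.mem_flatMap, mem_fan]
    constructor
    · rintro ⟨i, hi, ⟨rfl, h⟩, h'⟩
      exact ⟨⟨hi, h⟩, h'⟩
    · rintro ⟨⟨hi, h⟩, h'⟩
      exact ⟨_, hi, ⟨rfl, h⟩, h'⟩

theorem pairwise_fans (ε : ℝ) (m : ℕ) {R : Fin n → Fin n → Prop} {I : List (Fin n)}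
    (hI : I.Pairwise R) :
    (I.flatMap (fan ε m)).Pairwise fun r s => Conflict r s → R r.ctrl s.ctrl := by
  refine List.pairwise_flatMap.2 ⟨fun i _ => ?_, hI.imp fun {i j} hij r hr s hs _ => ?_⟩
  · refine List.pairwise_of_forall_mem_list fun r hr s hs hc => ?_
    have h1 := (mem_fan.1 hr).1
    have h2 := (mem_fan.1 hs).1
    rcases hc with hc | hc
    · exact absurd (hc ▸ h1.1 : s.tgt = i) h2.2.1.ne'
    · exact absurd (hc ▸ h2.1 : r.tgt = i) h1.2.1.ne'
  · rwa [(mem_fan.1 hr).1.1, (mem_fan.1 hs).1.1]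

theorem tailQubits_pairwise_lt : (tailQubits n).Pairwise (· < ·) :=
  (List.pairwise_lt_finRange _).filter _

theorem mem_tailQubits {i : Fin n} : i ∈ tailQubits n ↔ 0 < i.val := by simp [tailQubits]

theorem mem_headQubit {i : Fin n} : i ∈ headQubit n ↔ i.val = 0 := by simp [headQubit]

theorem tailQubits_nodup : (tailQubits n).Nodup := (List.nodup_finRange n).filter _

theorem headQubit_nodup : (headQubit n).Nodup := (List.nodup_finRange n).filter _

variable (n) in
/-- The fans with targets below `m` of all controls but `0`, in decreasing order of the
controls. -/
noncomputable def descFans (ε : ℝ) (m : ℕ) : List (Rot n) :=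
  (tailQubits n).reverse.flatMap (fan ε m)

variable (n) in
/-- The fans with targets below `m` of all controls but `0`, in increasing order of the
controls. -/
noncomputable def ascFans (ε : ℝ) (m : ℕ) : List (Rot n) := (tailQubits n).flatMap (fan ε m)

variable (n) in
/-- The fan of the control `0` with targets below `m`. -/
noncomputable def headFan (ε : ℝ) (m : ℕ) : List (Rot n) := (headQubit n).flatMap (fan ε m)

theorem enumerates_descFans (ε : ℝ) (m : ℕ) :
    Enumerates (descFans n ε m) (fun i j => 0 < i.val ∧ i < j ∧ j.val < m)
      (fun i j => ε * angle i j) := by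
  simpa only [descFans, List.mem_reverse, mem_tailQubits] using
    enumerates_fans ε m (List.nodup_reverse.2 (tailQubits_nodup (n := n)))

theorem enumerates_ascFans (ε : ℝ) (m : ℕ) :
    Enumerates (ascFans n ε m) (fun i j => 0 < i.val ∧ i < j ∧ j.val < m)
      (fun i j => ε * angle i j) := by
  simpa only [ascFans, mem_tailQubits] using enumerates_fans ε m (tailQubits_nodup (n := n))

theorem enumerates_headFan (ε : ℝ) (m : ℕ) :
    Enumerates (headFan n ε m) (fun i j => i.val = 0 ∧ i < j ∧ j.val < m)
      (fun i j => ε * angle i j) := by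
  simpa only [headFan, mem_headQubit] using enumerates_fans ε m (headQubit_nodup (n := n))

theorem pairwise_ascFans (ε : ℝ) (m : ℕ) :
    (ascFans n ε m).Pairwise fun r s => Conflict r s → r.ctrl < s.ctrl :=
  pairwise_fans ε m tailQubits_pairwise_lt

variable (n) in
/-- The angles of the construction, with the sign `ε` for the control `0` only. -/
noncomputable def headSignedAngle (ε : ℝ) (i j : Fin n) : ℝ :=
  (if i.val = 0 then ε else 1) * angle i j

/-- The positive fans below `m`, followed by the fan of the control `0`, whose sign is `ε`. -/
theorem enumerates_descFans_headFan (ε : ℝ) (m : ℕ) :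
    Enumerates (descFans n 1 m ++ headFan n ε m) (fun i j => i < j ∧ j.val < m)
      (headSignedAngle n ε) := by
  have h := (enumerates_descFans (n := n) 1 m).append (enumerates_headFan ε m)
    (β := headSignedAngle n ε) (fun i j h h' => by omega)
    (fun i j h => by simp [headSignedAngle, h.1.ne']) (fun i j h => by simp [headSignedAngle, h.1])
  refine ⟨h.1, fun r => ?_⟩
  rw [h.2]
  refine and_congr_left fun _ => ?_
  omega

theorem pairwise_descFans_headFan (ε : ℝ) (m : ℕ) :
    (descFans n 1 m ++ headFan n ε m).Pairwise fun r s => Conflict r s → s.ctrl < r.ctrl := by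
  refine List.pairwise_append.2 ⟨?_, ?_, ?_⟩
  · exact pairwise_fans 1 m (R := fun i j => j < i)
      (List.pairwise_reverse.2 tailQubits_pairwise_lt)
  · refine pairwise_fans ε m (R := fun i j => j < i) ?_
    refine ((List.pairwise_lt_finRange n).filter _).imp_of_mem fun {i j} hi hj h => ?_
    have hi := mem_headQubit.1 hi
    have hj := mem_headQubit.1 hj
    omega
  · intro r hr s hs _
    have h1 := ((enumerates_descFans _ _).2 r).1 hr
    have h2 := ((enumerates_headFan _ _).2 s).1 hs
    omega

/-- The rotations on `t` with controls `lo, …, t - 1`. -/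
noncomputable def column (lo : ℕ) (ε : ℝ) (t : Fin n) : List (Rot n) :=
  ((List.finRange n).filter fun i : Fin n => decide (lo ≤ i.val ∧ i.val < t.val)).map
    fun i : Fin n => ⟨ε * angle i.val t.val, i, t⟩

theorem mem_column {lo : ℕ} {ε : ℝ} {t : Fin n} {r : Rot n} :
    r ∈ column lo ε t ↔
      (lo ≤ r.ctrl.val ∧ r.ctrl < t ∧ r.tgt = t) ∧ r.angle = ε * angle r.ctrl r.tgt := by
  simp only [column, List.mem_map, List.mem_filter, List.mem_finRange, true_and,
    decide_eq_true_eq]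
  constructor
  · rintro ⟨i, h, rfl⟩
    exact ⟨⟨h.1, h.2, rfl⟩, rfl⟩
  · rintro ⟨⟨h1, h2, rfl⟩, h'⟩
    exact ⟨r.ctrl, ⟨h1, h2⟩, by rw [← h']⟩

theorem enumerates_column (lo : ℕ) (ε : ℝ) (t : Fin n) :
    Enumerates (column lo ε t) (fun i j => lo ≤ i.val ∧ i < t ∧ j = t)
      (fun i j => ε * angle i j) := by
  refine ⟨List.Nodup.map ?_ ((List.nodup_finRange n).filter _), fun r => mem_column⟩
  intro i i' h
  exact congrArg Rot.ctrl h

theorem pairwise_column (lo : ℕ) (ε : ℝ) (t : Fin n) (P : Rot n → Rot n → Prop) :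
    (column lo ε t).Pairwise fun r s => Conflict r s → P r s := by
  refine List.pairwise_of_forall_mem_list fun r hr s hs hc => ?_
  have h1 := (mem_column.1 hr).1
  have h2 := (mem_column.1 hs).1
  rcases hc with hc | hc
  · exact absurd (hc.trans h2.2.2) h1.2.1.ne
  · exact absurd (hc.trans h1.2.2) h2.2.1.ne

/-- The rotations on the last target `t` can be executed first. -/
theorem reordering_descFans_succ (t : Fin n) :
    Reordering (descFans n 1 (t + 1) ++ headFan n 1 (t + 1))
      (column 0 1 t ++ (descFans n 1 t ++ headFan n 1 t)) := by
  have hc := enumerates_column 0 1 t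
  have hd := enumerates_descFans_headFan (n := n) 1 t
  have h := hc.append hd (β := fun i j => 1 * angle i j) (fun i j h h' => by omega)
    (fun _ _ _ => rfl) (fun i j _ => by simp [headSignedAngle])
  refine Reordering.of_perm (P := fun r s => s.ctrl < r.ctrl) (fun r s => lt_asymm)
    ((enumerates_descFans_headFan 1 (t + 1)).perm h (fun i j => by omega)
      (fun i j _ => by simp [headSignedAngle]))
    (pairwise_descFans_headFan _ _) (List.pairwise_append.2
      ⟨pairwise_column _ _ _ _, pairwise_descFans_headFan _ _, fun r hr s hs hrs => ?_⟩)
  have h1 := ((hc.2 r).1 hr).1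
  have h2 := ((hd.2 s).1 hs).1
  rcases hrs with e | e <;> omega

/-- The rotations on the last target `t` can be executed last. -/
theorem reordering_ascFans_succ (t : Fin n) :
    Reordering (ascFans n (-1) (t + 1)) (ascFans n (-1) t ++ column 1 (-1) t) := by
  have hc := enumerates_column 1 (-1) t
  have hd := enumerates_ascFans (n := n) (-1) t
  have h := hd.append hc (β := fun i j => -1 * angle i j) (fun i j h h' => by omega)
    (fun _ _ _ => rfl) (fun _ _ _ => rfl)
  refine Reordering.of_perm (P := fun r s => r.ctrl < s.ctrl) (fun r s => lt_asymm)
    ((enumerates_ascFans (-1) (t + 1)).perm h (fun i j => by omega) (fun i j _ => rfl))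
    (pairwise_ascFans _ _) (List.pairwise_append.2
      ⟨pairwise_ascFans _ _, pairwise_column _ _ _ _, fun r hr s hs hrs => ?_⟩)
  have h1 := ((hd.2 r).1 hr).1
  have h2 := ((hc.2 s).1 hs).1
  rcases hrs with e | e <;> omega

theorem countP_range (a b k : ℕ) :
    (List.range k).countP (fun j => decide (a ≤ j ∧ j < b)) = min k b - a := by
  induction k with
  | zero => simp
  | succ k ih =>
    rw [List.range_succ, List.countP_append, ih, List.countP_singleton]
    simp only [decide_eq_true_eq]
    split_ifs <;> omega

theorem length_column (lo : ℕ) (ε : ℝ) (t : Fin n) : (column lo ε t).length = t - lo := by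
  have h := countP_range lo t n
  rw [← List.map_coe_finRange_eq_range, List.countP_map] at h
  rw [column, List.length_map, ← List.countP_eq_length_filter]
  refine h.trans ?_
  omega

theorem fans_one (I : List (Fin n)) (ε : ℝ) : I.flatMap (fan ε 1) = [] := by
  refine List.flatMap_eq_nil_iff.2 fun i _ => List.eq_nil_iff_forall_not_mem.2 fun r hr => ?_
  have := (mem_fan.1 hr).1
  omega

theorem length_fans {m : ℕ} (h1 : 1 ≤ m) (hm : m ≤ n) :
    2 * ((descFans n 1 m ++ headFan n 1 m).length : ℤ) = m * (m - 1) ∧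
      2 * ((ascFans n (-1) m).length : ℤ) = (m - 1) * (m - 2) := by
  induction m, h1 using Nat.le_induction with
  | base => simp [descFans, headFan, ascFans, fans_one]
  | succ m h1 ih =>
    obtain ⟨ih1, ih2⟩ := ih (by omega)
    have e1 := (reordering_descFans_succ (⟨m, hm⟩ : Fin n)).perm.length_eq
    have e2 := (reordering_ascFans_succ (⟨m, hm⟩ : Fin n)).perm.length_eq
    rw [List.length_append (as := column _ _ _), length_column] at e1
    rw [List.length_append, length_column] at e2
    zify [h1] at e1 e2
    constructor
    · push_cast at *; linear_combination 2 * e1 + ih1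
    · push_cast at *; linear_combination 2 * e2 + ih2

theorem length_headFan (ε : ℝ) (m : ℕ) : (headFan n ε m).length = (headFan n 1 m).length := by
  simp [headFan, List.length_flatMap, fan]

theorem length_construction {n : ℕ} (hn : 2 ≤ n) :
    ((construction n).length : ℤ) = 2 * (n : ℤ) ^ 2 - 6 * n + 5 := by
  obtain ⟨h1, h2⟩ := length_fans (n := n) (m := n) (by omega) le_rfl
  obtain ⟨h3, h4⟩ := length_fans (n := n) (m := n - 1) (by omega) (by omega)
  have e : construction n = descFans n 1 n ++ headFan n 1 n ++ ascFans n (-1) n ++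
    descFans n 1 (n - 1) ++ headFan n (-1) (n - 1) ++ ascFans n (-1) (n - 1) := rfl
  rw [e]
  simp only [List.length_append, length_headFan (-1)] at *
  push_cast [Nat.cast_sub (show 1 ≤ n by omega)] at *
  linarith

end Fans

/-! ### The construction implements the Toffoli gate -/

section Increment

variable {n : ℕ}

/-- The weight of qubit `i` in the angles `π / 2 ^ t * weight i` of the rotations on qubit `t`. -/
noncomputable def weight (i : ℕ) : ℝ := if i = 0 then 2 else 2 ^ i

theorem angle_eq {i t : ℕ} (h : i < t) : angle i t = Real.pi / 2 ^ t * weight i := by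
  unfold angle weight
  split_ifs with hi
  · obtain ⟨t, rfl⟩ : ∃ s, t = s + 1 := ⟨t - 1, by omega⟩
    rw [Nat.add_sub_cancel, pow_succ]
    field_simp
  · obtain ⟨d, rfl⟩ := Nat.exists_eq_add_of_lt h
    rw [show i + d + 1 - i = d + 1 by omega, show i + d + 1 = i + (d + 1) by ring, pow_add]
    field_simp
    ring

/-- The sum of the weights of those qubits among `lo, …, m - 1` whose bit is `1`. -/
noncomputable def value (lo m : ℕ) (x : Fin n → Fin 2) : ℝ :=
  ∑ i : Fin n, if lo ≤ i.val ∧ i.val < m ∧ x i = 1 then weight i else 0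

theorem value_zero (lo : ℕ) (x : Fin n → Fin 2) : value lo 0 x = 0 := by
  simp [value]

theorem value_succ (lo : ℕ) (t : Fin n) (x : Fin n → Fin 2) :
    value lo (t + 1) x = value lo t x + if lo ≤ t.val ∧ x t = 1 then weight t else 0 := by
  have h : (if lo ≤ t.val ∧ x t = 1 then weight t else 0) =
      ∑ i : Fin n, if i = t then (if lo ≤ i.val ∧ x i = 1 then weight i else 0) else 0 := by
    simp
  rw [h, value, value, ← Finset.sum_add_distrib]
  refine Finset.sum_congr rfl fun i _ => ?_
  by_cases hi : i = t
  · subst hi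
    simp
  · have : i.val < t.val + 1 ↔ i.val < t.val := by omega
    simp [hi, this]

theorem value_congr {lo m : ℕ} {x y : Fin n → Fin 2} (h : ∀ i : Fin n, i.val < m → x i = y i) :
    value lo m x = value lo m y := by
  refine Finset.sum_congr rfl fun i _ => ?_
  by_cases hi : i.val < m
  · rw [h i hi]
  · simp [hi]

theorem sum_map_filter {ι : Type*} (l : List ι) (p : ι → Prop) [DecidablePred p] (f : ι → ℝ) :
    ((l.filter fun a => decide (p a)).map f).sum = (l.map fun a => if p a then f a else 0).sum := by
  induction l with
  | nil => rfl
  | cons a l ih => by_cases h : p a <;> simp [h, ih]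

theorem run_column (lo : ℕ) (ε : ℝ) (t : Fin n) (v : (Fin n → Fin 2) → ℂ) :
    run (column lo ε t) v = turn t (fun x => ε * (Real.pi / 2 ^ t.val * value lo t x)) v := by
  rw [run_same_target (t := t)]
  · congr 1
    ext x
    rw [column, List.map_map, sum_map_filter, ← Fin.sum_univ_def, value, Finset.mul_sum,
      Finset.mul_sum]
    refine Finset.sum_congr rfl fun i _ => ?_
    by_cases hi : lo ≤ i.val ∧ i.val < t.val
    · by_cases hx : x i = 1 <;> simp [ctrlAngle_singleton, hi, hx, angle_eq hi.2]
    · have : ¬ (lo ≤ i.val ∧ i.val < t.val ∧ x i = 1) := fun h => hi ⟨h.1, h.2.1⟩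
      rw [if_neg hi, if_neg this, mul_zero, mul_zero]
  · intro r hr
    have := (mem_column.1 hr).1
    exact ⟨this.2.2, this.2.1.ne⟩

/-- The rotation by `π` of qubit `t` conditioned on all the qubits before it. -/
noncomputable def carry (t : Fin n) (v : (Fin n → Fin 2) → ℂ) : (Fin n → Fin 2) → ℂ :=
  turn t (fun x => if ∀ i < t, x i = 1 then Real.pi else 0) v

/-- The permutation of the basis states induced by `carry t`. -/
def carryFlip (t : Fin n) (x : Fin n → Fin 2) : Fin n → Fin 2 :=
  if ∀ i < t, x i = 1 then flip t x else x

theorem carryFlip_of_ne {t i : Fin n} (h : i ≠ t) (x : Fin n → Fin 2) :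
    carryFlip t x i = x i := by
  unfold carryFlip
  split_ifs
  · exact flip_of_ne h x
  · rfl

theorem forall_carryFlip (t : Fin n) (x : Fin n → Fin 2) :
    (∀ i < t, carryFlip t x i = 1) ↔ ∀ i < t, x i = 1 :=
  forall₂_congr fun i hi => by rw [carryFlip_of_ne hi.ne]

theorem carryFlip_carryFlip (t : Fin n) (x : Fin n → Fin 2) :
    carryFlip t (carryFlip t x) = x := by
  by_cases h : ∀ i < t, x i = 1
  · have h' : carryFlip t x = flip t x := if_pos h
    have h'' : carryFlip t (carryFlip t x) = flip t (carryFlip t x) :=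
      if_pos ((forall_carryFlip t x).2 h)
    rw [h'', h', flip_flip]
  · have h' : carryFlip t x = x := if_neg h
    rw [h', h']

theorem forall_flip {t t' : Fin n} (h : t < t') (x : Fin n → Fin 2) :
    (∀ i < t, flip t' x i = 1) ↔ ∀ i < t, x i = 1 :=
  forall₂_congr fun i hi => by rw [flip_of_ne (hi.trans h).ne]

theorem carryFlip_flip {t t' : Fin n} (h : t < t') (x : Fin n → Fin 2) :
    carryFlip t (flip t' x) = flip t' (carryFlip t x) := by
  unfold carryFlip
  rw [if_congr (forall_flip h x) rfl rfl]
  split_ifs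
  · exact flip_comm t t' x
  · rfl

theorem carry_apply (t : Fin n) (v : (Fin n → Fin 2) → ℂ) (x : Fin n → Fin 2) :
    carry t v x = (if ∀ i < t, x i = 1 then -Complex.I else 1) * v (carryFlip t x) := by
  by_cases h : ∀ i < t, x i = 1
  · simp only [carry, turn, carryFlip, if_pos h]
    simp
  · simp only [carry, turn, carryFlip, if_neg h]
    simp

theorem turn_carry {t t' : Fin n} (h : t < t') (α : (Fin n → Fin 2) → ℝ)
    (v : (Fin n → Fin 2) → ℂ) :
    turn t' α (carry t v) = carry t (turn t' (fun x => α (carryFlip t x)) v) := by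
  ext x
  rw [carry_apply]
  simp only [turn, carry_apply, carryFlip_flip h, forall_flip h, carryFlip_carryFlip]
  ring

variable (n) in
/-- The first three parts of the construction, with targets below `m`. -/
noncomputable def increment (m : ℕ) : List (Rot n) :=
  descFans n 1 m ++ headFan n 1 m ++ ascFans n (-1) m

theorem increment_one : increment n 1 = [] := by
  simp [increment, descFans, headFan, ascFans, fans_one]

variable (n) in
/-- The operator of `increment n m` adds the bit of qubit `0` to the binary number in the qubits
`1, …, m - 1`, up to phases: conjugation by it changes the condition of a rotation of a further
qubit according to a map `q` of the basis states, and `q` satisfies the equation of the addition,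
with the overflow on the left. -/
def IsIncrement (m : ℕ) : Prop :=
  ∃ q : (Fin n → Fin 2) → (Fin n → Fin 2),
    (∀ (t : Fin n) (α : (Fin n → Fin 2) → ℝ) (v : (Fin n → Fin 2) → ℂ), m ≤ t.val →
      turn t α (run (increment n m) v) = run (increment n m) (turn t (fun x => α (q x)) v)) ∧
    (∀ x (i : Fin n), m ≤ i.val → q x i = x i) ∧
    ∀ x, value 1 m (q x) + (if ∀ i : Fin n, i.val < m → x i = 1 then 2 ^ m else 0) = value 0 m x

theorem IsIncrement.run_succ {t : Fin n} (h : IsIncrement n t) (v : (Fin n → Fin 2) → ℂ) :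
    run (increment n (t + 1)) v = run (increment n t) (carry t v) := by
  obtain ⟨q, h1, -, h3⟩ := h
  rw [increment, ((reordering_descFans_succ t).append (reordering_ascFans_succ t)).run_eq]
  have e : column 0 1 t ++ (descFans n 1 t ++ headFan n 1 t) ++
      (ascFans n (-1) t ++ column 1 (-1) t) =
      column 0 1 t ++ increment n t ++ column 1 (-1) t := by
    simp [increment]
  rw [e, run_append, run_append, run_column, run_column, h1 t _ _ le_rfl, turn_turn]
  · unfold carry
    congr 2
    ext x
    rw [← h3 x]
    have : (∀ i : Fin n, i.val < t.val → x i = 1) ↔ ∀ i < t, x i = 1 := Iff.rfl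
    simp only [this]
    split_ifs
    · field_simp
      ring
    · ring
  · intro x
    rw [value_congr fun i hi => flip_of_ne (Fin.ne_of_lt hi) x]

theorem forall_lt_succ (t : Fin n) (x : Fin n → Fin 2) :
    (∀ i : Fin n, i.val < t.val + 1 → x i = 1) ↔
      (∀ i : Fin n, i.val < t.val → x i = 1) ∧ x t = 1 := by
  refine ⟨fun h => ⟨fun i hi => h i (by omega), h t (by omega)⟩, fun h i hi => ?_⟩
  by_cases e : i = t
  · rw [e, h.2]
  · exact h.1 i (by omega)

theorem isIncrement {m : ℕ} (h1 : 1 ≤ m) (hm : m ≤ n) : IsIncrement n m := by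
  induction m, h1 using Nat.le_induction with
  | base =>
    refine ⟨id, fun t α v _ => by rw [increment_one]; rfl, fun _ _ _ => rfl, fun x => ?_⟩
    have hv := value_succ 0 (⟨0, hm⟩ : Fin n) x
    have hv' := value_succ 1 (⟨0, hm⟩ : Fin n) x
    have hf := forall_lt_succ (⟨0, hm⟩ : Fin n) x
    simp only [Nat.zero_add, value_zero] at hv hv' hf
    rw [id, hv, hv', if_congr hf rfl rfl]
    by_cases hx : x ⟨0, hm⟩ = 1 <;> simp [hx, weight]
  | succ m h1 ih =>
    have hI := ih (by omega)
    have hrun := fun v => IsIncrement.run_succ (t := (⟨m, hm⟩ : Fin n)) hI v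
    obtain ⟨q, hq1, hq2, hq3⟩ := hI
    set t : Fin n := ⟨m, hm⟩ with ht
    refine ⟨fun x => q (carryFlip t x), fun s α v hs => ?_, fun x i hi => ?_, fun x => ?_⟩
    · have hts : t < s := hs
      rw [hrun, hrun, hq1 s _ _ (by omega), turn_carry hts]
    · have hti : t < i := hi
      exact (hq2 _ _ (by omega)).trans (carryFlip_of_ne hti.ne' x)
    · have e1 := value_succ 1 t (q (carryFlip t x))
      have e2 := value_succ 0 t x
      have e3 := hq3 (carryFlip t x)
      have e4 : value 0 m (carryFlip t x) = value 0 m x :=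
        value_congr fun i hi => carryFlip_of_ne (Fin.ne_of_lt hi) x
      have hf := forall_lt_succ t x
      have hF := forall_carryFlip t x
      have hw : weight m = 2 ^ m := if_neg (by omega)
      have two : ∀ a : Fin 2, a + 1 = 1 ↔ ¬ a = 1 := by decide
      change value 1 (m + 1) _ = value 1 m _ + _ at e1
      change value 0 (m + 1) _ = value 0 m _ + _ at e2
      change (∀ i : Fin n, i.val < m + 1 → x i = 1) ↔
        (∀ i : Fin n, i.val < m → x i = 1) ∧ x t = 1 at hf
      change (∀ i : Fin n, i.val < m → _) ↔ (∀ i : Fin n, i.val < m → _) at hF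
      rw [hq2 _ t le_rfl] at e1
      rw [e4, if_congr hF rfl rfl] at e3
      rw [e1, e2, ← e3, if_congr hf rfl rfl]
      have ht1 : t.val = m := rfl
      by_cases hall : ∀ i : Fin n, i.val < m → x i = 1
      · have hc : carryFlip t x t = x t + 1 := by
          rw [carryFlip, if_pos (show ∀ i < t, x i = 1 from hall), flip_same]
        rw [if_pos hall, hc]
        by_cases hx : x t = 1
        · rw [if_neg (fun h => (two _).1 h.2 hx), if_pos ⟨hall, hx⟩, if_pos ⟨Nat.zero_le _, hx⟩,
            ht1, hw, pow_succ]
          ring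
        · rw [if_pos ⟨h1, (two _).2 hx⟩, if_neg (fun h => hx h.2), if_neg (fun h => hx h.2),
            ht1, hw]
      · have hc : carryFlip t x = x := if_neg hall
        have h01 : 1 ≤ t.val ∧ x t = 1 ↔ 0 ≤ t.val ∧ x t = 1 :=
          and_congr_left' (iff_of_true h1 (Nat.zero_le t.val))
        rw [if_neg hall, hc, if_congr h01 rfl rfl,
          if_neg (c := (∀ i : Fin n, i.val < m → x i = 1) ∧ x t = 1) (fun h => hall h.1)]
        ring

/-- Parts four to six undo the first three parts on all qubits but the last. -/
theorem run_decrement_increment (m : ℕ) (v : (Fin n → Fin 2) → ℂ) :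
    run (descFans n 1 m ++ headFan n (-1) m ++ ascFans n (-1) m) (run (increment n m) v) = v := by
  have hwf : ∀ r ∈ increment n m, r.ctrl ≠ r.tgt := by
    intro r hr
    rw [increment, List.mem_append, (enumerates_descFans_headFan 1 m).2,
      (enumerates_ascFans (-1) m).2] at hr
    rintro e
    omega
  have e1 : Reordering (descFans n 1 m) ((ascFans n (-1) m).map Rot.neg).reverse := by
    refine Reordering.of_perm (P := fun r s => s.ctrl < r.ctrl) (fun r s => lt_asymm)
      ((enumerates_descFans 1 m).perm (enumerates_ascFans (-1) m).reverse_neg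
        (fun _ _ => Iff.rfl) (fun i j _ => by ring))
      (List.pairwise_append.1 (pairwise_descFans_headFan 1 m)).1 ?_
    rw [List.pairwise_reverse, List.pairwise_map]
    exact (pairwise_ascFans (-1) m).imp fun h hc => h hc.symm
  have e2 : Reordering (headFan n (-1) m) ((headFan n 1 m).map Rot.neg).reverse := by
    refine Reordering.of_perm (P := fun r s => s.ctrl < r.ctrl) (fun r s => lt_asymm)
      ((enumerates_headFan (-1) m).perm (enumerates_headFan 1 m).reverse_neg
        (fun _ _ => Iff.rfl) (fun i j _ => by ring))
      (List.pairwise_append.1 (pairwise_descFans_headFan (-1) m)).2.1 ?_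
    rw [List.pairwise_reverse, List.pairwise_map]
    refine List.pairwise_of_forall_mem_list fun r hr s hs hc => ?_
    have h1 := ((enumerates_headFan 1 m).2 r).1 hr
    have h2 := ((enumerates_headFan 1 m).2 s).1 hs
    rcases hc with hc | hc <;> simp only [Rot.neg] at hc <;> omega
  have e3 : Reordering (ascFans n (-1) m) ((descFans n 1 m).map Rot.neg).reverse := by
    refine Reordering.of_perm (P := fun r s => r.ctrl < s.ctrl) (fun r s => lt_asymm)
      ((enumerates_ascFans (-1) m).perm (enumerates_descFans 1 m).reverse_neg
        (fun _ _ => Iff.rfl) (fun i j _ => by ring)) (pairwise_ascFans (-1) m) ?_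
    rw [List.pairwise_reverse, List.pairwise_map]
    exact (List.pairwise_append.1 (pairwise_descFans_headFan 1 m)).1.imp fun h hc => h hc.symm
  rw [((e1.append e2).append e3).run_eq]
  convert run_reverse_neg hwf v using 2
  simp [increment]

theorem ctrl_ne_tgt_of_mem_construction : ∀ r ∈ construction n, r.ctrl ≠ r.tgt := by
  intro r hr e
  have e' : construction n = (descFans n 1 n ++ headFan n 1 n) ++ ascFans n (-1) n ++
    ((descFans n 1 (n - 1) ++ headFan n (-1) (n - 1)) ++ ascFans n (-1) (n - 1)) := by
    simp only [← List.append_assoc]; rfl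
  rw [e'] at hr
  rw [List.mem_append, List.mem_append, List.mem_append (s := descFans _ _ _ ++ _),
    (enumerates_descFans_headFan _ _).2, (enumerates_descFans_headFan _ _).2,
    (enumerates_ascFans _ _).2, (enumerates_ascFans _ _).2] at hr
  omega

theorem opOf_construction {t : Fin n} (hn : 2 ≤ n) (ht : t.val + 1 = n) :
    opOf ((construction n).map Gate.rot) = toffoli t := by
  refine Matrix.mulVec_injective (funext fun v => ?_)
  have ht' : t.val = n - 1 := by omega
  have e : construction n = increment n n ++
      (descFans n 1 (n - 1) ++ headFan n (-1) (n - 1) ++ ascFans n (-1) (n - 1)) := by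
    simp only [increment, ← List.append_assoc]; rfl
  have hs := IsIncrement.run_succ (isIncrement (m := t) (by omega) t.isLt.le) v
  rw [ht, ht'] at hs
  rw [opOf_mulVec ctrl_ne_tgt_of_mem_construction, e, run_append, hs, run_decrement_increment,
    toffoli, ctrlRx_mulVec (by simp), carry]
  congr 1
  ext x
  refine if_congr ⟨fun h i hi => h i ?_, fun h i hi => h i ?_⟩ rfl rfl
  · have h1 : i.val ≠ t.val := fun e => Finset.ne_of_mem_erase hi (Fin.ext e)
    omega
  · exact Finset.mem_erase.2 ⟨hi.ne, Finset.mem_univ _⟩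

end Increment

/-! ### Networks of rotations and SWAP gates on a line -/

section Network

variable {k : ℕ}

/-- The SWAP gate on the neighbouring sites `s` and `s + 1`. -/
def swapAt (s : Fin k) : Gate (k + 1) := .swap s.castSucc s.succ

/-- The rotation by `α i j` on `j` conditioned on `i`, where `i < j` are the two given qubits. -/
def meetRot (α : Fin (k + 1) → Fin (k + 1) → ℝ) (p : Fin (k + 1) × Fin (k + 1)) : Rot (k + 1) :=
  if p.1 < p.2 then ⟨α p.1 p.2, p.1, p.2⟩ else ⟨α p.2 p.1, p.2, p.1⟩

/-- The gate on the sites `s` and `s + 1` that performs, in the arrangement `σ`, the rotation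
`meetRot α` of the two qubits held there. -/
def meetGate (α : Fin (k + 1) → Fin (k + 1) → ℝ) (σ : Equiv.Perm (Fin (k + 1))) (s : Fin k) :
    Gate (k + 1) :=
  if σ s.castSucc < σ s.succ then .rot ⟨α (σ s.castSucc) (σ s.succ), s.castSucc, s.succ⟩
  else .rot ⟨α (σ s.succ) (σ s.castSucc), s.succ, s.castSucc⟩

/-- The circuit that goes through a list of layers, a layer being a list of sites `s`: in each
layer, the qubits at the sites `s` and `s + 1` first undergo their rotation `meetRot α` and are then
exchanged.  The initial arrangement is `σ`. -/
def network (α : Fin (k + 1) → Fin (k + 1) → ℝ) :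
    Equiv.Perm (Fin (k + 1)) → List (List (Fin k)) → Circuit (k + 1)
  | _, [] => []
  | σ, S :: Ls =>
      S.map (meetGate α σ) :: S.map swapAt :: network α (arrange σ (S.map swapAt)) Ls

/-- The pairs of qubits that meet in the network with the given layers, in order of time. -/
def meets : Equiv.Perm (Fin (k + 1)) → List (List (Fin k)) → List (Fin (k + 1) × Fin (k + 1))
  | _, [] => []
  | σ, S :: Ls =>
      S.map (fun s => (σ s.castSucc, σ s.succ)) ++ meets (arrange σ (S.map swapAt)) Ls

/-- The arrangement after the network with the given layers. -/
def arrangeLayers : Equiv.Perm (Fin (k + 1)) → List (List (Fin k)) → Equiv.Perm (Fin (k + 1))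
  | σ, [] => σ
  | σ, S :: Ls => arrangeLayers (arrange σ (S.map swapAt)) Ls

theorem gates_cons {n : ℕ} (L : List (Gate n)) (c : Circuit n) :
    Circuit.gates (L :: c) = L ++ Circuit.gates c := rfl

theorem gates_append {n : ℕ} (c d : Circuit n) :
    Circuit.gates (c ++ d) = c.gates ++ d.gates := List.flatten_append

theorem arrange_meetGate (α : Fin (k + 1) → Fin (k + 1) → ℝ) (σ τ : Equiv.Perm (Fin (k + 1)))
    (S : List (Fin k)) : arrange σ (S.map (meetGate α τ)) = σ := by
  induction S with
  | nil => rfl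
  | cons s S ih =>
    rw [List.map_cons, meetGate]
    split_ifs <;> exact ih

theorem rotations_meetGate (α : Fin (k + 1) → Fin (k + 1) → ℝ) (σ : Equiv.Perm (Fin (k + 1)))
    (S : List (Fin k)) :
    rotations σ (S.map (meetGate α σ)) =
      (S.map fun s => (σ s.castSucc, σ s.succ)).map (meetRot α) := by
  induction S with
  | nil => rfl
  | cons s S ih =>
    rw [List.map_cons, List.map_cons, List.map_cons, ← ih, meetGate, meetRot]
    split_ifs <;> rfl

theorem rotations_swapAt (σ : Equiv.Perm (Fin (k + 1))) (S : List (Fin k)) :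
    rotations σ (S.map swapAt) = [] :=
  rotations_eq_nil (by simp [swapAt, Gate.isSwap]) σ

theorem arrange_network (α : Fin (k + 1) → Fin (k + 1) → ℝ) (σ : Equiv.Perm (Fin (k + 1)))
    (Ls : List (List (Fin k))) :
    arrange σ (network α σ Ls).gates = arrangeLayers σ Ls := by
  induction Ls generalizing σ with
  | nil => rfl
  | cons S Ls ih =>
    rw [network, gates_cons, gates_cons, arrange_append, arrange_append, arrange_meetGate, ih,
      arrangeLayers]

theorem rotations_network (α : Fin (k + 1) → Fin (k + 1) → ℝ) (σ : Equiv.Perm (Fin (k + 1)))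
    (Ls : List (List (Fin k))) :
    rotations σ (network α σ Ls).gates = (meets σ Ls).map (meetRot α) := by
  induction Ls generalizing σ with
  | nil => rfl
  | cons S Ls ih =>
    rw [network, gates_cons, gates_cons, rotations_append, rotations_append, rotations_meetGate,
      arrange_meetGate, rotations_swapAt, ih, meets, List.map_append, List.nil_append]

theorem arrange_mul {n : ℕ} (σ τ : Equiv.Perm (Fin n)) (l : List (Gate n)) :
    arrange (σ * τ) l = σ * arrange τ l := by
  induction l generalizing τ with
  | nil => rfl
  | cons g l ih =>
    cases g with
    | rot r => exact ih τ
    | swap a b => rw [arrange, arrange, mul_assoc, ih]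

theorem arrangeLayers_mul (σ τ : Equiv.Perm (Fin (k + 1))) (Ls : List (List (Fin k))) :
    arrangeLayers (σ * τ) Ls = σ * arrangeLayers τ Ls := by
  induction Ls generalizing τ with
  | nil => rfl
  | cons S Ls ih => rw [arrangeLayers, arrangeLayers, arrange_mul, ih]

theorem meets_mul (σ τ : Equiv.Perm (Fin (k + 1))) (Ls : List (List (Fin k))) :
    meets (σ * τ) Ls = (meets τ Ls).map (Prod.map σ σ) := by
  induction Ls generalizing τ with
  | nil => rfl
  | cons S Ls ih =>
    rw [meets, meets, arrange_mul, ih, List.map_append, List.map_map]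
    rfl

theorem depth_network (α : Fin (k + 1) → Fin (k + 1) → ℝ) (σ : Equiv.Perm (Fin (k + 1)))
    (Ls : List (List (Fin k))) : (network α σ Ls).depth = 2 * Ls.length := by
  induction Ls generalizing σ with
  | nil => rfl
  | cons S Ls ih =>
    have := ih (arrange σ (S.map swapAt))
    simp only [Circuit.depth, network, List.length_cons] at this ⊢
    omega

theorem sites_meetGate (α : Fin (k + 1) → Fin (k + 1) → ℝ) (σ : Equiv.Perm (Fin (k + 1)))
    (s : Fin k) : (meetGate α σ s).sites = {s.castSucc, s.succ} := by
  rw [meetGate]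
  split_ifs
  · rfl
  · exact Finset.pair_comm _ _

theorem sites_swapAt (s : Fin k) : (swapAt s).sites = {s.castSucc, s.succ} := rfl

theorem isSwap_meetGate (α : Fin (k + 1) → Fin (k + 1) → ℝ) (σ : Equiv.Perm (Fin (k + 1)))
    (s : Fin k) : (meetGate α σ s).isSwap = false := by
  rw [meetGate]
  split_ifs <;> rfl

theorem isSwap_swapAt (s : Fin k) : (swapAt s).isSwap = true := rfl

theorem swapCount_network (α : Fin (k + 1) → Fin (k + 1) → ℝ) (σ : Equiv.Perm (Fin (k + 1)))
    (Ls : List (List (Fin k))) : (network α σ Ls).swapCount = (network α σ Ls).rotCount := by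
  induction Ls generalizing σ with
  | nil => rfl
  | cons S Ls ih =>
    have h := ih (arrange σ (S.map swapAt))
    simp only [Circuit.swapCount, Circuit.rotCount] at h ⊢
    simp only [network, gates_cons, List.countP_append, List.countP_map, h]
    simp [Function.comp_def, isSwap_meetGate, isSwap_swapAt]

theorem rotCount_network (α : Fin (k + 1) → Fin (k + 1) → ℝ) (σ : Equiv.Perm (Fin (k + 1)))
    (Ls : List (List (Fin k))) :
    (network α σ Ls).rotCount = (Ls.map List.length).sum := by
  induction Ls generalizing σ with
  | nil => rfl
  | cons S Ls ih =>
    have h := ih (arrange σ (S.map swapAt))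
    simp only [Circuit.rotCount] at h ⊢
    simp only [network, gates_cons, List.countP_append, List.countP_map, h]
    simp [Function.comp_def, isSwap_meetGate, isSwap_swapAt]

theorem adj_of_pathGraph_le {G : SimpleGraph (Fin (k + 1))}
    (hG : SimpleGraph.pathGraph (k + 1) ≤ G) (s : Fin k) : G.Adj s.castSucc s.succ :=
  hG (SimpleGraph.pathGraph_adj.2 (.inl (by simp)))

theorem isLocal_swapAt {G : SimpleGraph (Fin (k + 1))}
    (hG : SimpleGraph.pathGraph (k + 1) ≤ G) (s : Fin k) : (swapAt s).IsLocal G :=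
  adj_of_pathGraph_le hG s

theorem isLocal_network {G : SimpleGraph (Fin (k + 1))}
    (hG : SimpleGraph.pathGraph (k + 1) ≤ G) (α : Fin (k + 1) → Fin (k + 1) → ℝ)
    (σ : Equiv.Perm (Fin (k + 1))) (Ls : List (List (Fin k))) :
    (network α σ Ls).IsLocal G := by
  induction Ls generalizing σ with
  | nil => simp [network, Circuit.IsLocal]
  | cons S Ls ih =>
    intro L hL g hg
    rw [network, List.mem_cons, List.mem_cons] at hL
    rcases hL with rfl | rfl | hL
    · obtain ⟨s, -, rfl⟩ := List.mem_map.1 hg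
      rw [meetGate]
      split_ifs
      · exact adj_of_pathGraph_le hG s
      · exact (adj_of_pathGraph_le hG s).symm
    · obtain ⟨s, -, rfl⟩ := List.mem_map.1 hg
      exact isLocal_swapAt hG s
    · exact ih _ L hL g hg

theorem disjoint_sites {s s' : Fin k} (h : s.val + 1 < s'.val) :
    Disjoint ({s.castSucc, s.succ} : Finset (Fin (k + 1))) {s'.castSucc, s'.succ} := by
  rw [Finset.disjoint_left]
  intro x hx hx'
  simp only [Finset.mem_insert, Finset.mem_singleton, Fin.ext_iff, Fin.val_castSucc,
    Fin.val_succ] at hx hx'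
  omega

theorem isScheduled_network (α : Fin (k + 1) → Fin (k + 1) → ℝ) (σ : Equiv.Perm (Fin (k + 1)))
    {Ls : List (List (Fin k))} (h : ∀ S ∈ Ls, S.Pairwise fun s s' => s.val + 1 < s'.val) :
    (network α σ Ls).IsScheduled := by
  induction Ls generalizing σ with
  | nil => simp [network, Circuit.IsScheduled]
  | cons S Ls ih =>
    have hS := h S List.mem_cons_self
    intro L hL
    rw [network, List.mem_cons, List.mem_cons] at hL
    rcases hL with rfl | rfl | hL
    · refine List.pairwise_map.2 (hS.imp fun {s s'} hs => ?_)
      rw [sites_meetGate, sites_meetGate]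
      exact disjoint_sites hs
    · exact List.pairwise_map.2 (hS.imp fun {s s'} hs => disjoint_sites hs)
    · exact ih _ (fun S' hS' => h S' (List.mem_cons_of_mem _ hS')) L hL

theorem arrange_swapAt_of_ne (σ : Equiv.Perm (Fin (k + 1))) {S : List (Fin k)} {x : Fin (k + 1)}
    (h : ∀ s ∈ S, x ≠ s.castSucc ∧ x ≠ s.succ) : arrange σ (S.map swapAt) x = σ x := by
  induction S generalizing σ with
  | nil => rfl
  | cons s S ih =>
    have hs := h s List.mem_cons_self
    rw [List.map_cons, swapAt, arrange, ih _ fun t ht => h t (List.mem_cons_of_mem _ ht),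
      Equiv.Perm.mul_apply, Equiv.swap_apply_of_ne_of_ne hs.1 hs.2]

theorem arrange_swapAt (σ : Equiv.Perm (Fin (k + 1))) {S : List (Fin k)}
    (hS : S.Pairwise fun s s' => s.val + 1 < s'.val) {s : Fin k} (hs : s ∈ S) :
    arrange σ (S.map swapAt) s.castSucc = σ s.succ ∧
      arrange σ (S.map swapAt) s.succ = σ s.castSucc := by
  induction S generalizing σ with
  | nil => simp at hs
  | cons t S ih =>
    rw [List.pairwise_cons] at hS
    rw [List.map_cons, swapAt, arrange]
    rcases List.mem_cons.1 hs with rfl | hs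
    · rw [arrange_swapAt_of_ne, arrange_swapAt_of_ne]
      · simp
      all_goals
        intro t ht
        have := hS.1 t ht
        simp only [ne_eq, Fin.ext_iff, Fin.val_castSucc, Fin.val_succ]
        omega
    · have := hS.1 s hs
      rw [(ih _ hS.2 hs).1, (ih _ hS.2 hs).2, Equiv.Perm.mul_apply, Equiv.Perm.mul_apply,
        Equiv.swap_apply_of_ne_of_ne, Equiv.swap_apply_of_ne_of_ne]
      · simp
      all_goals
        simp only [ne_eq, Fin.ext_iff, Fin.val_castSucc, Fin.val_succ]
        omega

end Network

/-! ### The triangular network -/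

section Triangle

variable {k : ℕ}

/-- The sites `s` at which layer `T` of the triangular network on the sites `0, …, m - 1` exchanges
`s` and `s + 1`: those with `|m - 2 - T| ≤ s ≤ m - 2` and the parity of `m + T`. -/
def Active (m T s : ℕ) : Prop := m ≤ s + T + 2 ∧ T + 2 ≤ s + m ∧ s + 2 ≤ m ∧ (s + T + m) % 2 = 0

instance (m T s : ℕ) : Decidable (Active m T s) := by unfold Active; infer_instance

variable (k) in
/-- The list of the active sites in layer `T`. -/
def layer (m T : ℕ) : List (Fin k) :=
  (List.finRange k).filter fun s : Fin k => decide (Active m T s.val)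

variable (k) in
/-- The layers `a, …, a + len - 1` of the triangular network. -/
def layers (m a len : ℕ) : List (List (Fin k)) := (List.range' a len).map (layer k m)

variable (k) in
/-- The triangular network on the sites `0, …, m - 1`, in which every two of the `m` qubits meet
exactly once and which reverses their order. -/
def triangle (m : ℕ) : List (List (Fin k)) := layers k m 0 (2 * m - 3)

theorem length_triangle (m : ℕ) : (triangle k m).length = 2 * m - 3 := by
  simp [triangle, layers]

theorem layers_succ (m a len : ℕ) :
    layers k m a (len + 1) = layer k m a :: layers k m (a + 1) len := rfl

theorem mem_layer {m T : ℕ} {s : Fin k} : s ∈ layer k m T ↔ Active m T s.val := by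
  simp [layer]

theorem layer_pairwise_lt (m T : ℕ) : (layer k m T).Pairwise (· < ·) :=
  (List.pairwise_lt_finRange _).filter _

theorem layer_pairwise (m T : ℕ) :
    (layer k m T).Pairwise fun s s' => s.val + 1 < s'.val := by
  refine (layer_pairwise_lt m T).imp_of_mem fun {s s'} hs hs' h => ?_
  have h1 := mem_layer.1 hs
  have h2 := mem_layer.1 hs'
  unfold Active at h1 h2
  omega

theorem triangle_pairwise (m : ℕ) :
    ∀ S ∈ triangle k m, S.Pairwise fun s s' => s.val + 1 < s'.val := by
  intro S hS
  obtain ⟨T, -, rfl⟩ := List.mem_map.1 hS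
  exact layer_pairwise m T

/-- The qubit at site `x` after `T` layers of the triangular network. -/
def qubitAt (m T x : ℕ) : ℕ :=
  if m ≤ x then x
  else if x + T + 2 < m then x
  else if x + m < T + 2 then m - 1 - x
  else if (x + T + m) % 2 = 0 then (m + x - (T + 2)) / 2
  else (3 * m - 3 - T - x) / 2

theorem qubitAt_zero (m x : ℕ) : qubitAt m 0 x = x := by
  unfold qubitAt
  split_ifs <;> omega

theorem qubitAt_end {m : ℕ} (x : ℕ) :
    qubitAt m (2 * m - 3) x = if x < m then m - 1 - x else x := by
  unfold qubitAt
  split_ifs <;> omega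

theorem qubitAt_active {m T s : ℕ} (h : Active m T s) :
    2 * qubitAt m T s + T + 2 = m + s ∧ 2 * qubitAt m T (s + 1) + T + s + 4 = 3 * m := by
  unfold Active at h
  unfold qubitAt
  constructor <;> split_ifs <;> omega

theorem qubitAt_succ_left {m T s : ℕ} (h : Active m T s) :
    qubitAt m (T + 1) s = qubitAt m T (s + 1) := by
  unfold Active at h
  unfold qubitAt
  split_ifs <;> omega

theorem qubitAt_succ_right {m T s : ℕ} (h : Active m T s) :
    qubitAt m (T + 1) (s + 1) = qubitAt m T s := by
  unfold Active at h
  unfold qubitAt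
  split_ifs <;> omega

theorem qubitAt_succ_of_not_active {m T x : ℕ} (h : ¬ Active m T x)
    (h' : ∀ s, x = s + 1 → ¬ Active m T s) : qubitAt m (T + 1) x = qubitAt m T x := by
  rcases x with _ | s
  · unfold Active at h
    unfold qubitAt
    split_ifs <;> omega
  · have h' := h' s rfl
    unfold Active at h h'
    unfold qubitAt
    split_ifs <;> omega

/-- The arrangement `σ` is the one after `T` layers of the triangular network. -/
def Tracks (m T : ℕ) (σ : Equiv.Perm (Fin (k + 1))) : Prop :=
  ∀ x, (σ x).val = qubitAt m T x.val

theorem Tracks.succ {m T : ℕ} (hm : m ≤ k + 1) {σ : Equiv.Perm (Fin (k + 1))}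
    (h : Tracks m T σ) : Tracks m (T + 1) (arrange σ ((layer k m T).map swapAt)) := by
  intro x
  by_cases h1 : Active m T x.val
  · have hx : x.val < k := by unfold Active at h1; omega
    have e : x = Fin.castSucc ⟨x.val, hx⟩ := rfl
    have hs : (⟨x.val, hx⟩ : Fin k) ∈ layer k m T := mem_layer.2 h1
    rw [e, (arrange_swapAt σ (layer_pairwise m T) hs).1, h]
    exact (qubitAt_succ_left h1).symm
  by_cases h2 : ∃ s, x.val = s + 1 ∧ Active m T s
  · obtain ⟨s, hs, h2⟩ := h2
    have e : x = Fin.succ ⟨s, by omega⟩ := Fin.ext hs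
    rw [e, (arrange_swapAt σ (layer_pairwise m T) (mem_layer.2 h2)).2, h]
    exact (qubitAt_succ_right h2).symm
  push Not at h2
  rw [arrange_swapAt_of_ne, h, qubitAt_succ_of_not_active h1 h2]
  intro s hs
  refine ⟨?_, ?_⟩
  · rintro rfl
    have := mem_layer.1 hs
    exact h1 this
  · rintro rfl
    exact h2 s.val (by simp) (mem_layer.1 hs)

theorem Tracks.layers {m : ℕ} (hm : m ≤ k + 1) {a len : ℕ} (ha : a + len ≤ 2 * m - 3)
    {σ : Equiv.Perm (Fin (k + 1))} (h : Tracks m a σ) :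
    Tracks m (a + len) (arrangeLayers σ (layers k m a len)) := by
  induction len generalizing a σ with
  | zero => exact h
  | succ len ih =>
    rw [layers_succ, arrangeLayers, show a + (len + 1) = a + 1 + len by ring]
    exact ih (by omega) (h.succ hm)

theorem tracks_one (m : ℕ) : Tracks m 0 (1 : Equiv.Perm (Fin (k + 1))) :=
  fun x => (qubitAt_zero m x).symm

theorem arrangeLayers_triangle {m : ℕ} (hm : m ≤ k + 1) (x : Fin (k + 1)) :
    (arrangeLayers 1 (triangle k m) x).val = if x.val < m then m - 1 - x.val else x.val := by
  have h := (tracks_one m).layers hm (len := 2 * m - 3) (by omega) x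
  rw [Nat.zero_add, qubitAt_end] at h
  exact h

theorem Tracks.mem_meets {m : ℕ} (hm : m ≤ k + 1) {a len : ℕ} (ha : a + len = 2 * m - 3)
    {σ : Equiv.Perm (Fin (k + 1))} (h : Tracks m a σ) (p : Fin (k + 1) × Fin (k + 1)) :
    p ∈ meets σ (LinearToffoli.layers k m a len) ↔
      p.1 < p.2 ∧ p.2.val < m ∧ p.1.val + p.2.val + a + 3 ≤ 2 * m := by
  induction len generalizing a σ with
  | zero =>
    simp only [LinearToffoli.layers, List.range'_zero, List.map_nil, meets, List.not_mem_nil,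
      false_iff]
    omega
  | succ len ih =>
    rw [layers_succ, meets, List.mem_append, ih (by omega) (h.succ hm), List.mem_map]
    have key : (∃ s ∈ layer k m a, (σ s.castSucc, σ s.succ) = p) ↔
        p.1 < p.2 ∧ p.2.val < m ∧ p.1.val + p.2.val + a + 3 = 2 * m := by
      constructor
      · rintro ⟨s, hs, rfl⟩
        have h1 := h s.castSucc
        have h2 := h s.succ
        have h4 := mem_layer.1 hs
        have h3 := qubitAt_active h4
        simp only [Fin.val_castSucc, Fin.val_succ, Fin.lt_def] at h1 h2 ⊢
        unfold Active at h4
        omega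
      · rintro ⟨h1, h2, h3⟩
        have hs : Active m a (p.1.val + (m - 1 - p.2.val)) := by unfold Active; omega
        refine ⟨⟨p.1.val + (m - 1 - p.2.val), by omega⟩, mem_layer.2 hs, ?_⟩
        have h4 := qubitAt_active hs
        refine Prod.ext (Fin.ext ?_) (Fin.ext ?_)
        · rw [h]
          simp only [Fin.val_castSucc]
          omega
        · rw [h]
          simp only [Fin.val_succ]
          omega
    rw [key]
    omega

theorem Tracks.pairwise_meets {m : ℕ} (hm : m ≤ k + 1) {a len : ℕ} (ha : a + len = 2 * m - 3)
    {σ : Equiv.Perm (Fin (k + 1))} (h : Tracks m a σ) :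
    (meets σ (LinearToffoli.layers k m a len)).Pairwise fun p q =>
      q.1.val + q.2.val ≤ p.1.val + p.2.val ∧ p ≠ q := by
  induction len generalizing a σ with
  | zero => exact List.Pairwise.nil
  | succ len ih =>
    have h' := h.succ hm
    have hv : ∀ s ∈ layer k m a, 2 * (σ s.castSucc).val + a + 2 = m + s.val ∧
        2 * (σ s.succ).val + a + s.val + 4 = 3 * m := fun s hs => by
      have hs := mem_layer.1 hs
      rw [h, h]
      exact qubitAt_active hs
    rw [layers_succ, meets]
    refine List.pairwise_append.2 ⟨?_, ih (by omega) h', ?_⟩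
    · refine List.pairwise_map.2 ((layer_pairwise m a).imp_of_mem fun {s s'} hs hs' hss => ?_)
      have h1 := hv s hs
      have h2 := hv s' hs'
      refine ⟨by dsimp only; omega, fun e => ?_⟩
      have := congrArg (fun p => p.1.val) e
      dsimp only at this
      omega
    · intro p hp q hq
      obtain ⟨s, hs, rfl⟩ := List.mem_map.1 hp
      have h1 := hv s hs
      have h2 := (h'.mem_meets hm (by omega) q).1 hq
      refine ⟨by dsimp only; omega, fun e => ?_⟩
      rw [← e] at h2
      dsimp only at h2
      omega

theorem mem_meets_triangle {m : ℕ} (hm : m ≤ k + 1) (p : Fin (k + 1) × Fin (k + 1)) :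
    p ∈ meets 1 (triangle k m) ↔ p.1 < p.2 ∧ p.2.val < m := by
  rw [triangle, (tracks_one m).mem_meets hm (by omega)]
  omega

theorem pairwise_meets_triangle {m : ℕ} (hm : m ≤ k + 1) :
    (meets 1 (triangle k m)).Pairwise fun p q =>
      q.1.val + q.2.val ≤ p.1.val + p.2.val ∧ p ≠ q :=
  (tracks_one m).pairwise_meets hm (by omega)

/-- Started in the natural order of the qubits, the triangular network performs the rotations of
all pairs of qubits, in an order compatible with decreasing controls. -/
theorem reordering_triangle {m : ℕ} (hm : m ≤ k + 1) (ε : ℝ) :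
    Reordering
      (rotations 1 (network (headSignedAngle (k + 1) ε) 1 (triangle k m)).gates)
      (descFans (k + 1) 1 m ++ headFan (k + 1) ε m) := by
  rw [rotations_network]
  set α := headSignedAngle (k + 1) ε
  have hr : ∀ p ∈ meets 1 (triangle k m), meetRot α p = ⟨α p.1 p.2, p.1, p.2⟩ := fun p hp =>
    if_pos ((mem_meets_triangle hm p).1 hp).1
  have henum : Enumerates ((meets 1 (triangle k m)).map (meetRot α))
      (fun i j => i < j ∧ j.val < m) α := by
    refine ⟨List.pairwise_map.2 ((pairwise_meets_triangle hm).imp_of_mem ?_), fun r => ?_⟩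
    · intro p q hp hq hpq e
      rw [hr p hp, hr q hq] at e
      exact hpq.2 (Prod.ext (congrArg Rot.ctrl e) (congrArg Rot.tgt e))
    · rw [List.mem_map]
      constructor
      · rintro ⟨p, hp, rfl⟩
        rw [hr p hp]
        exact ⟨(mem_meets_triangle hm p).1 hp, rfl⟩
      · rintro ⟨h, h'⟩
        have hp := (mem_meets_triangle hm (r.ctrl, r.tgt)).2 h
        exact ⟨_, hp, by rw [hr _ hp, ← h']⟩
  refine Reordering.of_perm (P := fun r s => s.ctrl < r.ctrl) (fun r s => lt_asymm)
    (henum.perm (enumerates_descFans_headFan ε m) (fun _ _ => Iff.rfl) (fun _ _ _ => rfl)) ?_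
    (pairwise_descFans_headFan ε m)
  refine List.pairwise_map.2 ((pairwise_meets_triangle hm).imp_of_mem ?_)
  intro p q hp hq hpq hc
  have h1 := (mem_meets_triangle hm p).1 hp
  have h2 := (mem_meets_triangle hm q).1 hq
  rw [hr p hp, hr q hq] at hc ⊢
  rcases hc with hc | hc <;> dsimp only at hc ⊢ <;> omega

/-- Started in the reverse order `m, …, 1, 0` of the qubits, the triangular network on all the
sites but that of qubit `0` performs the rotations of all pairs of the qubits `1, …, m`, in an order
compatible with increasing controls. -/
theorem reordering_triangle_reverse {m : ℕ} (hm : m ≤ k) {σ : Equiv.Perm (Fin (k + 1))}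
    (hσ : ∀ x : Fin (k + 1), x.val < m + 1 → (σ x).val = m - x.val) :
    Reordering
      (rotations σ (network (fun i j => -1 * angle i j) σ (triangle k m)).gates)
      (ascFans (k + 1) (-1) (m + 1)) := by
  have hmeets := meets_mul σ 1 (triangle k m)
  rw [mul_one] at hmeets
  rw [rotations_network, hmeets, List.map_map]
  set α : Fin (k + 1) → Fin (k + 1) → ℝ := fun i j => -1 * angle i j
  have hm' : m ≤ k + 1 := by omega
  have hv : ∀ p ∈ meets 1 (triangle k m), (σ p.1).val = m - p.1.val ∧ (σ p.2).val = m - p.2.val :=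
    fun p hp => by
      have := (mem_meets_triangle hm' p).1 hp
      exact ⟨hσ _ (by omega), hσ _ (by omega)⟩
  have hr : ∀ p ∈ meets 1 (triangle k m),
      (meetRot α ∘ Prod.map σ σ) p = ⟨α (σ p.2) (σ p.1), σ p.2, σ p.1⟩ := fun p hp => by
    have h1 := (mem_meets_triangle hm' p).1 hp
    have h2 := hv p hp
    refine if_neg ?_
    dsimp only [Prod.map]
    omega
  have henum : Enumerates ((meets 1 (triangle k m)).map (meetRot α ∘ Prod.map σ σ))
      (fun i j => 0 < i.val ∧ i < j ∧ j.val < m + 1) α := by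
    refine ⟨List.pairwise_map.2 ((pairwise_meets_triangle hm').imp_of_mem ?_), fun r => ?_⟩
    · intro p q hp hq hpq e
      rw [hr p hp, hr q hq] at e
      exact hpq.2 (Prod.ext (σ.injective (congrArg Rot.tgt e)) (σ.injective (congrArg Rot.ctrl e)))
    · rw [List.mem_map]
      constructor
      · rintro ⟨p, hp, rfl⟩
        rw [hr p hp]
        have h1 := (mem_meets_triangle hm' p).1 hp
        have h2 := hv p hp
        refine ⟨?_, rfl⟩
        dsimp only
        omega
      · rintro ⟨h, h'⟩
        have hb : m - r.tgt.val < k + 1 := by omega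
        have hb' : m - r.ctrl.val < k + 1 := by omega
        have hp := (mem_meets_triangle hm' (⟨m - r.tgt.val, hb⟩, ⟨m - r.ctrl.val, hb'⟩)).2
          (by simp only [Fin.lt_def]; omega)
        have h1 : σ ⟨m - r.tgt.val, hb⟩ = r.tgt := Fin.ext (by rw [hσ] <;> dsimp only <;> omega)
        have h2 : σ ⟨m - r.ctrl.val, hb'⟩ = r.ctrl :=
          Fin.ext (by rw [hσ] <;> dsimp only <;> omega)
        exact ⟨_, hp, by rw [hr _ hp, h1, h2, ← h']⟩
  refine Reordering.of_perm (P := fun r s => r.ctrl < s.ctrl) (fun r s => lt_asymm)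
    (henum.perm (enumerates_ascFans (-1) (m + 1)) (fun _ _ => Iff.rfl) (fun _ _ _ => rfl)) ?_
    (pairwise_ascFans (-1) (m + 1))
  refine List.pairwise_map.2 ((pairwise_meets_triangle hm').imp_of_mem ?_)
  intro p q hp hq hpq hc
  have h1 := (mem_meets_triangle hm' p).1 hp
  have h2 := (mem_meets_triangle hm' q).1 hq
  have h3 := hv p hp
  have h4 := hv q hq
  rw [hr p hp, hr q hq] at hc ⊢
  rcases hc with hc | hc <;> dsimp only at hc ⊢ <;> omega

/-- Consecutive layers act on sites of different parities.  So a rotation never acts on the same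
pair of sites as a preceding SWAP gate, and the two-qubit operations are the rotations, each taken
together with the SWAP gate that follows it. -/
theorem sizeFrom_layers (α : Fin (k + 1) → Fin (k + 1) → ℝ) (m a len : ℕ)
    (σ : Equiv.Perm (Fin (k + 1))) {prev : List (Gate (k + 1))}
    (h : ∀ g ∈ prev, ∀ s ∈ layer k m a, g.sites ≠ {s.castSucc, s.succ}) :
    Circuit.sizeFrom prev (network α σ (layers k m a len)) =
      ((layers k m a len).map List.length).sum := by
  induction len generalizing a σ prev with
  | zero => rfl
  | succ len ih =>
    rw [layers_succ, network, Circuit.sizeFrom, Circuit.sizeFrom, ih]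
    · rw [List.filter_eq_self.2, List.filter_eq_nil_iff.2]
      · simp
      · intro g hg
        obtain ⟨s, hs, rfl⟩ := List.mem_map.1 hg
        rw [decide_eq_true_eq]
        exact fun hc => hc _ (List.mem_map_of_mem hs) (sites_meetGate α σ s)
      · intro g hg
        obtain ⟨s, hs, rfl⟩ := List.mem_map.1 hg
        rw [decide_eq_true_eq, sites_meetGate]
        exact fun g hg => h g hg s hs
    · intro g hg s hs e
      obtain ⟨t, ht, rfl⟩ := List.mem_map.1 hg
      rw [sites_swapAt] at e
      have h1 := mem_layer.1 ht
      have h2 := mem_layer.1 hs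
      have h3 : t.castSucc ∈ ({s.castSucc, s.succ} : Finset (Fin (k + 1))) := by
        rw [← e]; simp
      have h4 : t.succ ∈ ({s.castSucc, s.succ} : Finset (Fin (k + 1))) := by
        rw [← e]; simp
      simp only [Finset.mem_insert, Finset.mem_singleton, Fin.ext_iff, Fin.val_castSucc,
        Fin.val_succ] at h3 h4
      unfold Active at h1 h2
      omega

/-- Only the gates of the first layer may belong to a two-qubit operation that began before. -/
theorem sizeFrom_triangle (α : Fin (k + 1) → Fin (k + 1) → ℝ) (m : ℕ)
    (σ : Equiv.Perm (Fin (k + 1))) (prev : List (Gate (k + 1))) :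
    Circuit.sizeFrom prev (network α σ (triangle k m)) ≤ (network α σ (triangle k m)).rotCount ∧
      (network α σ (triangle k m)).rotCount ≤
        Circuit.sizeFrom prev (network α σ (triangle k m)) + k := by
  have h := sizeFrom_layers α m 0 (2 * m - 3) σ (prev := []) (by simp)
  rw [rotCount_network, triangle, ← h]
  rcases 2 * m - 3 with _ | len
  · exact ⟨le_rfl, Nat.le_add_right _ _⟩
  · rw [layers_succ, network, Circuit.sizeFrom, Circuit.sizeFrom]
    have h1 := List.length_filter_le
      (fun g : Gate (k + 1) => decide (∀ h ∈ prev, h.sites ≠ g.sites))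
      ((layer k m 0).map (meetGate α σ))
    have h2 : (layer k m 0).length ≤ k := by
      simpa [layer] using List.length_filter_le (fun s : Fin k => decide (Active m 0 s.val))
        (List.finRange k)
    rw [List.length_map] at h1
    have h3 : ((layer k m 0).map (meetGate α σ)).filter
        (fun g : Gate (k + 1) => decide (∀ h ∈ ([] : List (Gate (k + 1))), h.sites ≠ g.sites)) =
          (layer k m 0).map (meetGate α σ) :=
      List.filter_eq_self.2 fun g _ => by simp
    rw [Circuit.sizeFrom, Circuit.sizeFrom, h3, List.length_map]
    omega

end Triangle

/-! ### Moving a qubit to the first site -/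

section MoveDown

variable {k : ℕ}

/-- The circuit that moves the qubit at site `j` to site `0` by `j` successive SWAP gates. -/
def moveDown (j : ℕ) (hj : j ≤ k) : Circuit (k + 1) :=
  (List.finRange j).reverse.map fun s => [swapAt (Fin.castLE hj s)]

theorem moveDown_succ (j : ℕ) (hj : j + 1 ≤ k) :
    moveDown (j + 1) hj = [swapAt ⟨j, hj⟩] :: moveDown j (by omega) := by
  rw [moveDown, List.finRange_succ_last, List.reverse_append, ← List.map_reverse, List.map_append,
    List.map_map]
  rfl

theorem mem_moveDown {j : ℕ} {hj : j ≤ k} {L : List (Gate (k + 1))} (h : L ∈ moveDown j hj) :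
    ∃ s, L = [swapAt s] := by
  obtain ⟨s, -, rfl⟩ := List.mem_map.1 h
  exact ⟨_, rfl⟩

theorem depth_moveDown (j : ℕ) (hj : j ≤ k) : (moveDown j hj).depth = j := by
  simp [moveDown, Circuit.depth]

theorem onlySwaps_moveDown (j : ℕ) (hj : j ≤ k) : (moveDown j hj).OnlySwaps := by
  intro L hL g hg
  obtain ⟨s, rfl⟩ := mem_moveDown hL
  rw [List.mem_singleton.1 hg]
  rfl

theorem isScheduled_moveDown (j : ℕ) (hj : j ≤ k) : (moveDown j hj).IsScheduled := by
  intro L hL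
  obtain ⟨s, rfl⟩ := mem_moveDown hL
  exact List.pairwise_singleton _ _

theorem isLocal_moveDown {G : SimpleGraph (Fin (k + 1))}
    (hG : SimpleGraph.pathGraph (k + 1) ≤ G) (j : ℕ) (hj : j ≤ k) :
    (moveDown j hj).IsLocal G := by
  intro L hL g hg
  obtain ⟨s, rfl⟩ := mem_moveDown hL
  rw [List.mem_singleton.1 hg]
  exact isLocal_swapAt hG s

theorem count_moveDown (j : ℕ) (hj : j ≤ k) :
    (moveDown j hj).swapCount = j ∧ (moveDown j hj).rotCount = 0 := by
  induction j with
  | zero => exact ⟨rfl, rfl⟩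
  | succ j ih =>
    obtain ⟨h1, h2⟩ := ih (by omega)
    rw [Circuit.swapCount] at h1
    rw [Circuit.rotCount] at h2
    rw [Circuit.swapCount, Circuit.rotCount, moveDown_succ, gates_cons, List.countP_append,
      List.countP_append, h1, h2]
    simp [swapAt, Gate.isSwap, add_comm]

theorem rotations_moveDown (j : ℕ) (hj : j ≤ k) (σ : Equiv.Perm (Fin (k + 1))) :
    rotations σ (moveDown j hj).gates = [] := by
  rw [← List.length_eq_zero_iff, length_rotations]
  exact (count_moveDown j hj).2

theorem sizeFrom_le {n : ℕ} {c : Circuit n} (h : ∀ L ∈ c, L.length ≤ 1) (prev : List (Gate n)) :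
    Circuit.sizeFrom prev c ≤ c.depth := by
  induction c generalizing prev with
  | nil => exact le_rfl
  | cons L c ih =>
    have h1 := ih (fun L' hL' => h L' (List.mem_cons_of_mem _ hL')) L
    have h2 := h L List.mem_cons_self
    have h3 := List.length_filter_le
      (fun g : Gate n => decide (∀ h ∈ prev, h.sites ≠ g.sites)) L
    rw [Circuit.sizeFrom]
    simp only [Circuit.depth, List.length_cons] at h1 ⊢
    omega

theorem sizeFrom_moveDown (j : ℕ) (hj : j ≤ k) (prev : List (Gate (k + 1))) :
    Circuit.sizeFrom prev (moveDown j hj) ≤ j := by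
  refine (sizeFrom_le (fun L hL => ?_) prev).trans_eq (depth_moveDown j hj)
  obtain ⟨s, rfl⟩ := mem_moveDown hL
  exact le_rfl

theorem sizeFrom_append {n : ℕ} (c d : Circuit n) (prev : List (Gate n)) :
    ∃ prev', Circuit.sizeFrom prev (c ++ d) =
      Circuit.sizeFrom prev c + Circuit.sizeFrom prev' d := by
  induction c generalizing prev with
  | nil => exact ⟨prev, (Nat.zero_add _).symm⟩
  | cons L c ih =>
    obtain ⟨prev', h⟩ := ih L
    exact ⟨prev', by rw [List.cons_append, Circuit.sizeFrom, Circuit.sizeFrom, h, add_assoc]⟩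

/-- The qubit at site `j` gets to site `0`, and those at the sites below `j` move up by one site. -/
theorem arrange_moveDown (j : ℕ) (hj : j ≤ k) (σ : Equiv.Perm (Fin (k + 1)))
    {x y : Fin (k + 1)} (h : x.val = 0 ∧ y.val = j ∨ x.val ≤ j ∧ y.val + 1 = x.val ∨
      j < x.val ∧ y.val = x.val) :
    arrange σ (moveDown j hj).gates x = σ y := by
  induction j generalizing σ x y with
  | zero =>
    have : x = y := Fin.ext (by omega)
    rw [this]
    rfl
  | succ j ih =>
    rw [moveDown_succ, gates_cons, List.singleton_append, swapAt, arrange]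
    set a : Fin (k + 1) := Fin.castSucc ⟨j, hj⟩ with ha
    set b : Fin (k + 1) := Fin.succ ⟨j, hj⟩ with hb
    have hav : a.val = j := rfl
    have hbv : b.val = j + 1 := rfl
    -- the first SWAP takes the content of `y` to the site `z`
    have key : ∀ z : Fin (k + 1), Equiv.swap a b z = y →
        (x.val = 0 ∧ z.val = j ∨ x.val ≤ j ∧ z.val + 1 = x.val ∨ j < x.val ∧ z.val = x.val) →
        arrange (σ * Equiv.swap a b) (moveDown j (by omega : j ≤ k)).gates x = σ y := by
      intro z hz hxz
      rw [ih (by omega) _ hxz, Equiv.Perm.mul_apply, hz]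
    by_cases h1 : y = b
    · subst h1
      exact key a (Equiv.swap_apply_left _ _) (by omega)
    by_cases h2 : y = a
    · subst h2
      exact key b (Equiv.swap_apply_right _ _) (by omega)
    have h1' : y.val ≠ j + 1 := fun e => h1 (Fin.ext e)
    have h2' : y.val ≠ j := fun e => h2 (Fin.ext e)
    exact key y (Equiv.swap_apply_of_ne_of_ne h2 h1) (by omega)

/-- The triangular networks on `m + 1` and on `m` sites move the content of every site but the last
by one site; moving the last one to the first site restores the order. -/
theorem arrange_triangle_triangle_moveDown (m : ℕ) (hm : m ≤ k) :
    arrange (arrangeLayers (arrangeLayers 1 (triangle k (m + 1))) (triangle k m))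
      (moveDown m hm).gates = 1 := by
  set σ := arrangeLayers (1 : Equiv.Perm (Fin (k + 1))) (triangle k (m + 1)) with hσ
  set τ := arrangeLayers (1 : Equiv.Perm (Fin (k + 1))) (triangle k m) with hτ
  have hσv := fun x => arrangeLayers_triangle (k := k) (m := m + 1) (by omega) x
  have hτv := fun x => arrangeLayers_triangle (k := k) (m := m) (by omega) x
  rw [← hσ] at hσv
  rw [← hτ] at hτv
  have e := arrangeLayers_mul σ 1 (triangle k m)
  rw [mul_one, ← hτ] at e
  rw [e]
  ext x
  have hy : ∃ y : Fin (k + 1), x.val = 0 ∧ y.val = m ∨ x.val ≤ m ∧ y.val + 1 = x.val ∨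
      m < x.val ∧ y.val = x.val := by
    by_cases h0 : x.val = 0
    · exact ⟨⟨m, by omega⟩, .inl ⟨h0, rfl⟩⟩
    by_cases h1 : x.val ≤ m
    · exact ⟨⟨x.val - 1, by omega⟩, .inr (.inl ⟨h1, by dsimp only; omega⟩)⟩
    · exact ⟨x, by omega⟩
  obtain ⟨y, hy⟩ := hy
  rw [arrange_moveDown m hm _ hy, Equiv.Perm.mul_apply, hσv, hτv, Equiv.Perm.one_apply]
  split_ifs <;> omega

end MoveDown

/-! ### The circuit -/

theorem abs_sub_two_mul_sq_le {n a b : ℕ} (hn : 2 ≤ n)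
    (ha : (a : ℤ) = 2 * (n : ℤ) ^ 2 - 6 * n + 5) (h1 : a ≤ b + 4 * n) (h2 : b ≤ a + 4 * n) :
    |(b : ℝ) - 2 * (n : ℝ) ^ 2| ≤ 20 * (n : ℝ) := by
  have ha' : (a : ℝ) = 2 * (n : ℝ) ^ 2 - 6 * n + 5 := by exact_mod_cast ha
  have h1' : (a : ℝ) ≤ b + 4 * n := by exact_mod_cast h1
  have h2' : (b : ℝ) ≤ a + 4 * n := by exact_mod_cast h2
  have hn' : (2 : ℝ) ≤ n := by exact_mod_cast hn
  rw [abs_le]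
  constructor <;> linarith

end LinearToffoli

theorem theorem3 :
    ∃ C : ℝ, ∀ (n : ℕ) (hn : 2 ≤ n),
      ∃ P₁₂ P₃ K P₄₅ P₆ K' c : LinearToffoli.Circuit n,
        c = P₁₂ ++ P₃ ++ K ++ P₄₅ ++ P₆ ++ K' ∧
        -- a legal schedule with nearest-neighbour gates only, hence legal in every architecture
        -- whose sites are numbered so that consecutive ones interact
        c.IsScheduled ∧
        (∀ G : SimpleGraph (Fin n), SimpleGraph.pathGraph n ≤ G → c.IsLocal G) ∧
        -- it implements the `n`-qubit Toffoli gate and restores the order of the qubits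
        c.op = LinearToffoli.toffoli (⟨n - 1, by omega⟩ : Fin n) ∧
        LinearToffoli.arrange 1 c.gates = 1 ∧
        -- it performs the rotations of the construction, up to exchanging commuting ones
        LinearToffoli.Reordering (LinearToffoli.rotations 1 c.gates)
          (LinearToffoli.construction n) ∧
        -- the rotations of the several parts
        LinearToffoli.Reordering (LinearToffoli.rotations 1 P₁₂.gates)
          (LinearToffoli.part1 n ++ LinearToffoli.part2 n) ∧
        LinearToffoli.Reordering
          (LinearToffoli.rotations (LinearToffoli.arrange 1 P₁₂.gates) P₃.gates)
          (LinearToffoli.part3 n) ∧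
        LinearToffoli.Reordering (LinearToffoli.rotations 1 P₄₅.gates)
          (LinearToffoli.part4 n ++ LinearToffoli.part5 n) ∧
        LinearToffoli.Reordering
          (LinearToffoli.rotations (LinearToffoli.arrange 1 P₄₅.gates) P₆.gates)
          (LinearToffoli.part6 n) ∧
        -- the reordering circuits, the first of which restores the order of the qubits midway
        K.OnlySwaps ∧ K'.OnlySwaps ∧
        LinearToffoli.arrange 1 (P₁₂ ++ P₃ ++ K : LinearToffoli.Circuit n).gates = 1 ∧
        -- depth (all subtractions truncated at zero in the partial bounds)
        P₁₂.depth ≤ 4 * n - 6 ∧ P₃.depth ≤ 4 * n - 10 ∧ K.depth ≤ n + 5 ∧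
        P₄₅.depth ≤ 4 * n - 10 ∧ P₆.depth ≤ 4 * n - 14 ∧ K'.depth ≤ n + 4 ∧
        (c.depth : ℤ) ≤ 18 * (n : ℤ) - 31 ∧
        -- size
        K.swapCount ≤ 4 * n - 6 ∧ K'.swapCount ≤ 4 * n - 6 ∧
        (c.rotCount : ℤ) = 2 * (n : ℤ) ^ 2 - 6 * (n : ℤ) + 5 ∧
        |(c.swapCount : ℝ) - 2 * (n : ℝ) ^ 2| ≤ C * (n : ℝ) ∧
        |(c.size : ℝ) - 2 * (n : ℝ) ^ 2| ≤ C * (n : ℝ) := by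
  open LinearToffoli in
  refine ⟨20, fun n hn => ?_⟩
  obtain ⟨k, rfl⟩ : ∃ k, n = k + 2 := ⟨n - 2, by omega⟩
  -- all angles of the third and of the sixth part are negative
  let α₃ : Fin (k + 2) → Fin (k + 2) → ℝ := fun i j => -1 * angle i j
  set σ₁ := arrangeLayers (1 : Equiv.Perm (Fin (k + 2))) (triangle (k + 1) (k + 2)) with hσ₁
  set σ₄ := arrangeLayers (1 : Equiv.Perm (Fin (k + 2))) (triangle (k + 1) (k + 1)) with hσ₄
  obtain ⟨P₁₂, hP₁₂⟩ : ∃ P, P = network (headSignedAngle (k + 2) 1) 1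
      (triangle (k + 1) (k + 2)) := ⟨_, rfl⟩
  obtain ⟨P₃, hP₃⟩ : ∃ P, P = network α₃ σ₁ (triangle (k + 1) (k + 1)) := ⟨_, rfl⟩
  obtain ⟨K, hK⟩ : ∃ P, P = moveDown (k := k + 1) (k + 1) le_rfl := ⟨_, rfl⟩
  obtain ⟨P₄₅, hP₄₅⟩ : ∃ P, P = network (headSignedAngle (k + 2) (-1)) 1
      (triangle (k + 1) (k + 1)) := ⟨_, rfl⟩
  obtain ⟨P₆, hP₆⟩ : ∃ P, P = network α₃ σ₄ (triangle (k + 1) k) := ⟨_, rfl⟩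
  obtain ⟨K', hK'⟩ : ∃ P, P = moveDown (k := k + 1) k (Nat.le_succ k) := ⟨_, rfl⟩
  have a₁ : arrange 1 P₁₂.gates = σ₁ := by rw [hP₁₂, arrange_network]
  have a₄ : arrange 1 P₄₅.gates = σ₄ := by rw [hP₄₅, arrange_network]
  have aK : arrange (arrange σ₁ P₃.gates) K.gates = 1 := by
    rw [hP₃, arrange_network, hK, hσ₁, arrange_triangle_triangle_moveDown]
  have aK' : arrange (arrange σ₄ P₆.gates) K'.gates = 1 := by
    rw [hP₆, arrange_network, hK', hσ₄, arrange_triangle_triangle_moveDown]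
  have r₁ : Reordering (rotations 1 P₁₂.gates) (part1 (k + 2) ++ part2 (k + 2)) := by
    rw [hP₁₂]
    exact reordering_triangle le_rfl 1
  have r₄ : Reordering (rotations 1 P₄₅.gates) (part4 (k + 2) ++ part5 (k + 2)) := by
    rw [hP₄₅]
    exact reordering_triangle (Nat.le_succ _) (-1)
  have r₃ : Reordering (rotations σ₁ P₃.gates) (part3 (k + 2)) := by
    rw [hP₃]
    refine reordering_triangle_reverse le_rfl fun x hx => ?_
    rw [hσ₁, arrangeLayers_triangle le_rfl, if_pos hx]
    rfl
  have r₆ : Reordering (rotations σ₄ P₆.gates) (part6 (k + 2)) := by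
    rw [hP₆]
    refine reordering_triangle_reverse (Nat.le_succ k) fun x hx => ?_
    rw [hσ₄, arrangeLayers_triangle (Nat.le_succ _), if_pos hx]
    rfl
  have rK : ∀ σ, rotations σ K.gates = [] := by rw [hK]; exact rotations_moveDown _ _
  have rK' : ∀ σ, rotations σ K'.gates = [] := by rw [hK']; exact rotations_moveDown _ _
  have d₁ : P₁₂.depth = 2 * (2 * (k + 2) - 3) := by
    rw [hP₁₂, depth_network, length_triangle]
  have d₃ : P₃.depth = 2 * (2 * (k + 1) - 3) := by rw [hP₃, depth_network, length_triangle]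
  have d₄ : P₄₅.depth = 2 * (2 * (k + 1) - 3) := by rw [hP₄₅, depth_network, length_triangle]
  have d₆ : P₆.depth = 2 * (2 * k - 3) := by rw [hP₆, depth_network, length_triangle]
  have dK : K.depth = k + 1 := by rw [hK, depth_moveDown]
  have dK' : K'.depth = k := by rw [hK', depth_moveDown]
  have sK : K.swapCount = k + 1 ∧ K.rotCount = 0 := by rw [hK]; exact count_moveDown _ _
  have sK' : K'.swapCount = k ∧ K'.rotCount = 0 := by rw [hK']; exact count_moveDown _ _
  obtain ⟨c, hc⟩ : ∃ c, c = P₁₂ ++ P₃ ++ K ++ P₄₅ ++ P₆ ++ K' := ⟨_, rfl⟩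
  have gates : c.gates = P₁₂.gates ++ (P₃.gates ++ (K.gates ++
      (P₄₅.gates ++ (P₆.gates ++ K'.gates)))) := by
    simp only [hc, gates_append, List.append_assoc]
  have ac : arrange 1 c.gates = 1 := by
    rw [gates]
    simp only [arrange_append]
    rw [a₁, aK, a₄, aK']
  have rc : Reordering (rotations 1 c.gates) (construction (k + 2)) := by
    rw [gates]
    simp only [rotations_append]
    rw [a₁, aK, a₄, rK, rK', List.nil_append, List.append_nil]
    have := r₁.append (r₃.append (r₄.append r₆))
    simpa only [construction, List.append_assoc] using this
  have hrot : (c.rotCount : ℤ) = 2 * ((k + 2 : ℕ) : ℤ) ^ 2 - 6 * ((k + 2 : ℕ) : ℤ) + 5 := by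
    rw [Circuit.rotCount, ← length_rotations _ 1, rc.perm.length_eq, length_construction hn]
  have hrotc : c.rotCount = P₁₂.rotCount + P₃.rotCount + P₄₅.rotCount + P₆.rotCount := by
    have h1 := sK.2
    have h2 := sK'.2
    simp only [Circuit.rotCount, gates, List.countP_append] at h1 h2 ⊢
    omega
  have hswapc : c.swapCount = c.rotCount + (2 * k + 1) := by
    have h1 := sK.1
    have h2 := sK'.1
    have e₁ : P₁₂.swapCount = P₁₂.rotCount := by rw [hP₁₂, swapCount_network]
    have e₃ : P₃.swapCount = P₃.rotCount := by rw [hP₃, swapCount_network]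
    have e₄ : P₄₅.swapCount = P₄₅.rotCount := by rw [hP₄₅, swapCount_network]
    have e₆ : P₆.swapCount = P₆.rotCount := by rw [hP₆, swapCount_network]
    rw [hrotc, ← e₁, ← e₃, ← e₄, ← e₆]
    simp only [Circuit.swapCount, gates, List.countP_append] at h1 h2 ⊢
    omega
  have hsize : c.rotCount ≤ c.size + 4 * (k + 1) ∧ c.size ≤ c.rotCount + (2 * k + 1) := by
    obtain ⟨p₆, q₆⟩ := sizeFrom_append (P₁₂ ++ P₃ ++ K ++ P₄₅ ++ P₆) K' []
    obtain ⟨p₅, q₅⟩ := sizeFrom_append (P₁₂ ++ P₃ ++ K ++ P₄₅) P₆ []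
    obtain ⟨p₄, q₄⟩ := sizeFrom_append (P₁₂ ++ P₃ ++ K) P₄₅ []
    obtain ⟨p₃, q₃⟩ := sizeFrom_append (P₁₂ ++ P₃) K []
    obtain ⟨p₂, q₂⟩ := sizeFrom_append P₁₂ P₃ []
    have z₁ := sizeFrom_triangle (headSignedAngle (k + 2) 1) (k + 2) 1 []
    have z₂ := sizeFrom_triangle α₃ (k + 1) σ₁ p₂
    have z₃ := sizeFrom_moveDown (k := k + 1) (k + 1) le_rfl p₃
    have z₄ := sizeFrom_triangle (headSignedAngle (k + 2) (-1)) (k + 1) 1 p₄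
    have z₅ := sizeFrom_triangle α₃ k σ₄ p₅
    have z₆ := sizeFrom_moveDown (k := k + 1) k (Nat.le_succ k) p₆
    rw [← hP₁₂] at z₁
    rw [← hP₃] at z₂
    rw [← hK] at z₃
    rw [← hP₄₅] at z₄
    rw [← hP₆] at z₅
    rw [← hK'] at z₆
    rw [hrotc, Circuit.size, hc]
    omega
  refine ⟨P₁₂, P₃, K, P₄₅, P₆, K', c, hc, ?_, ?_, ?_, ac, rc, r₁, ?_, r₄, ?_, ?_, ?_, ?_, ?_, ?_,
    ?_, ?_, ?_, ?_, ?_, ?_, ?_, hrot, ?_, ?_⟩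
  · intro L hL
    rw [hc] at hL
    simp only [List.mem_append] at hL
    rcases hL with ((((hL | hL) | hL) | hL) | hL) | hL
    · exact isScheduled_network _ _ (triangle_pairwise _) L (hP₁₂ ▸ hL)
    · exact isScheduled_network _ _ (triangle_pairwise _) L (hP₃ ▸ hL)
    · exact isScheduled_moveDown _ _ L (hK ▸ hL)
    · exact isScheduled_network _ _ (triangle_pairwise _) L (hP₄₅ ▸ hL)
    · exact isScheduled_network _ _ (triangle_pairwise _) L (hP₆ ▸ hL)
    · exact isScheduled_moveDown _ _ L (hK' ▸ hL)
  · intro G hG L hL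
    rw [hc] at hL
    simp only [List.mem_append] at hL
    rcases hL with ((((hL | hL) | hL) | hL) | hL) | hL
    · exact isLocal_network hG _ _ _ L (hP₁₂ ▸ hL)
    · exact isLocal_network hG _ _ _ L (hP₃ ▸ hL)
    · exact isLocal_moveDown hG _ _ L (hK ▸ hL)
    · exact isLocal_network hG _ _ _ L (hP₄₅ ▸ hL)
    · exact isLocal_network hG _ _ _ L (hP₆ ▸ hL)
    · exact isLocal_moveDown hG _ _ L (hK' ▸ hL)
  · rw [Circuit.op, opOf_eq_of_arrange_eq_one ac, ← opOf_construction hn rfl]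
    refine Matrix.mulVec_injective (funext fun v => ?_)
    rw [opOf_mulVec (ctrl_ne_tgt_of_mem_construction), opOf_mulVec, rc.run_eq]
    exact fun r hr => ctrl_ne_tgt_of_mem_construction r (rc.perm.mem_iff.1 hr)
  · rwa [a₁]
  · rwa [a₄]
  · rw [hK]; exact onlySwaps_moveDown _ _
  · rw [hK']; exact onlySwaps_moveDown _ _
  · rw [gates_append, gates_append, arrange_append, arrange_append, a₁, aK]
  · omega
  · omega
  · omega
  · omega
  · omega
  · omega
  · have : c.depth = P₁₂.depth + P₃.depth + K.depth + P₄₅.depth + P₆.depth + K'.depth := by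
      simp only [Circuit.depth, hc, List.length_append]
    push_cast
    omega
  · omega
  · omega
  · exact abs_sub_two_mul_sq_le hn hrot (by omega) (by omega)
  · exact abs_sub_two_mul_sq_le hn hrot (by omega) (by omega)
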